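/- **Setup.** For matrices $A\in\mathbb R^{n\times n}$, $B\in\mathbb R^{n\times p}$ and an activation $\phi:\mathbb R\to\mathbb R$ (applied entrywise), consider $h_{t+1}=\phi(Ah_t+Bu_t)$, $h_0=0$, with inputs $u_0,u_1,\dots\overset{\text{i.i.d.}}{\sim}\mathcal N(0,I_p)$. Let $\|A\|$ be the spectral norm, $\Sigma[\cdot]$ the covariance matrix, $\preceq$ the Loewner order, and for a random vector $X$ let $\|X\|_{\psi_2}=\sup_{\|v\|_2\le1}\sup_{k\ge1}k^{-1/2}(\mathbb E|v^TX|^k)^{1/k}$. For $0\le\beta\le1$, $\phi$ is $\beta$-increasing if $\phi(0)=0$, $\phi$ is $1$-Lipschitz and $\beta\le\phi'\le1$; at points where $\phi$ is not differentiable (as for leaky ReLU) $\phi'$ denotes an arbitrary fixed value in $[\beta,1]$. **Well-behaved state vector.** Given $K>0$, an integer $L>1$ and scalars $\gamma_+,\gamma_->0$, $\theta\ge0$, the state vector is well-behaved if $\theta\le3\sqrt n$, $\Sigma[h_{L-1}]\succeq\gamma_-I_n$, and for all $t\ge0$: $\Sigma[h_t]\preceq\gamma_+I_n$, $\|h_t-\mathbb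 E h_t\|_{\psi_2}\le K\sqrt{\gamma_+}$ and $\|\mathbb E h_t\|_2\le\theta\sqrt{\gamma_+}$. **SGD.** Given a scaling $\mu>0$ and a trajectory up to time $N+1$, set for $1\le t\le N$: $x_t=[\mu h_t^T\ u_t^T]^T\in\mathbb R^{n+p}$, $y_t=h_{t+1}$, and let $C_\star=[\mu^{-1}A\ \ B]\in\mathbb R^{n\times(n+p)}$, so that $y_t=\phi(C_\star x_t)$. With $\mathcal L_t(\Theta)=\frac12\|y_t-\phi(\Theta x_t)\|_2^2$ and learning rate $\eta$, SGD from $\Theta_0$ is $\Theta_\tau=\Theta_{\tau-1}-\eta\nabla\mathcal L_{r_\tau}(\Theta_{\tau-1})$, where $r_1,r_2,\dots$ are independent and uniform on $\{1,\dots,N\}$ and independent of the trajectory; the gradient is formed by the chain rule with $\phi'$. **Theorem.** For every $K>0$ there are constants $C,c,c_0,c_1>0$, depending only on $K$, such that the following holds. Suppose $\|A\|<1$, $\phi$ is $\beta$-increasing, $\gamma_+\ge\gamma_->0$, $\rho=\gamma_+/\gamma_-$, $L=\left\lceil1-\frac{\log(cn\rho)}{\log\|A\|}\right\rceil$, the state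 vector is well-behaved with $K,L,\gamma_+,\gamma_-,\theta$, and $$N\ge CL\rho^2(n+p).$$ Take $\mu=1/\sqrt{\gamma_+}$ and $\eta=c_0\frac{\beta^2}{\rho(\theta+\sqrt2)^2(n+p)}$. Then with probability at least $1-4N\exp(-100n)-8L\exp\left(-c_1\frac{N}{L\rho^2}\right)$ over the trajectory, for all initial points $\Theta_0\in\mathbb R^{n\times(n+p)}$ and all $\tau\ge0$, $$\mathbb E\left[\|\Theta_\tau-C_\star\|_F^2\right]\le\left(1-c_0\frac{\beta^4}{2\rho^2(\theta+\sqrt2)^2(n+p)}\right)^{\tau}\|\Theta_0-C_\star\|_F^2,$$ where the expectation is over the randomness of the SGD indices only. -/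

import Mathlib

open MeasureTheory ProbabilityTheory
open scoped BigOperators Matrix Matrix.Norms.L2Operator

namespace RNN

noncomputable section

/-- The activation `φ` is `β`-increasing: it is `1`-Lipschitz, `φ 0 = 0`, and its derivative takes
values in `[β, 1]`. The function `φ'` is the derivative used by the algorithm: it equals the
derivative of `φ` wherever `φ` is differentiable (everywhere, for a differentiable `φ`), and at the
remaining points (a null set, empty for a smooth `φ`, the kink for a leaky ReLU) it is an arbitrary
number in `[β, 1]`. -/
structure IsBetaIncreasing (β : ℝ) (φ φ' : ℝ → ℝ) : Prop where
  beta_nonneg : 0 ≤ β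
  beta_le_one : β ≤ 1
  map_zero : φ 0 = 0
  lipschitz : LipschitzWith 1 φ
  eq_deriv : ∀ x, DifferentiableAt ℝ φ x → φ' x = deriv φ x
  beta_le : ∀ x, β ≤ φ' x
  le_one : ∀ x, φ' x ≤ 1

/-- For a differentiable `φ` and `φ' = deriv φ`, the notion is literally
`φ 0 = 0` and `β ≤ φ' x ≤ 1` for all `x`. -/
theorem isBetaIncreasing_deriv_iff {β : ℝ} {φ : ℝ → ℝ} (hφ : Differentiable ℝ φ) (h0 : 0 ≤ β)
    (h1 : β ≤ 1) :
    IsBetaIncreasing β φ (deriv φ) ↔ φ 0 = 0 ∧ ∀ x, β ≤ deriv φ x ∧ deriv φ x ≤ 1 := by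
  constructor
  · intro h
    exact ⟨h.map_zero, fun x => ⟨h.beta_le x, h.le_one x⟩⟩
  · rintro ⟨hz, hx⟩
    refine ⟨h0, h1, hz, ?_, fun _ _ => rfl, fun x => (hx x).1, fun x => (hx x).2⟩
    refine lipschitzWith_of_nnnorm_deriv_le hφ fun x => ?_
    rw [← NNReal.coe_le_coe, coe_nnnorm, Real.norm_eq_abs, NNReal.coe_one, abs_le]
    exact ⟨by linarith [(hx x).1], (hx x).2⟩

variable {n p N : ℕ}

/-- The state trajectory `h_{t+1} = φ (A h_t + B u_t)`, `h_0 = 0` (`φ` acts entrywise), driven by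
the input sequence `u_0, u_1, …`. -/
def state (φ : ℝ → ℝ) (A : Matrix (Fin n) (Fin n) ℝ) (B : Matrix (Fin n) (Fin p) ℝ)
    (u : ℕ → Fin p → ℝ) : ℕ → Fin n → ℝ
  | 0 => 0
  | t + 1 => fun i => φ ((A *ᵥ state φ A B u t + B *ᵥ u t) i)

/-- The standard normal distribution `N(0, I_p)` on `ℝ^p`. -/
def stdNormal (p : ℕ) : Measure (Fin p → ℝ) := Measure.pi fun _ => gaussianReal 0 1

/-- Euclidean norm of a vector. -/
def eNorm {ι : Type*} [Fintype ι] (x : ι → ℝ) : ℝ := Real.sqrt (∑ i, x i ^ 2)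

/-- Squared Frobenius norm of a matrix. -/
def frobSq {ι κ : Type*} [Fintype ι] [Fintype κ] (M : Matrix ι κ ℝ) : ℝ := ∑ i, ∑ j, M i j ^ 2

section Probability

variable {Ω : Type*} [MeasurableSpace Ω]

/-- Mean vector of a random vector. -/
def meanVec (X : Ω → Fin n → ℝ) (μ : Measure Ω) : Fin n → ℝ := fun i => ∫ ω, X ω i ∂μ

/-- Covariance matrix of a random vector. -/
def covMatrix (X : Ω → Fin n → ℝ) (μ : Measure Ω) : Matrix (Fin n) (Fin n) ℝ :=
  Matrix.of fun i j => cov[fun ω => X ω i, fun ω => X ω j; μ]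

/-- Orlicz norm `sup_{k ≥ 1} k^{-1/a} (E |X|^k)^{1/k}` of a scalar random variable. -/
def orliczNorm (a : ℝ) (X : Ω → ℝ) (μ : Measure Ω) : ENNReal :=
  ⨆ (k : ℝ) (_ : 1 ≤ k), ENNReal.ofReal (k ^ (-(1 / a))) * eLpNorm X (ENNReal.ofReal k) μ

/-- Subgaussian norm of a random vector: the supremum of the Orlicz-`2` norms of `vᵀ X` over the
Euclidean unit ball. -/
def subgaussianNorm (X : Ω → Fin n → ℝ) (μ : Measure Ω) : ENNReal :=
  ⨆ (v : Fin n → ℝ) (_ : eNorm v ≤ 1), orliczNorm 2 (fun ω => v ⬝ᵥ X ω) μ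

/-- The process `h` is well behaved with parameters `L > 1`, `γ₊, γ₋ > 0`, `0 ≤ θ ≤ 3 √n` and
subgaussianity constant `K`. Matrix inequalities are in the Loewner order. -/
structure WellBehaved (K : ℝ) (L : ℕ) (γplus γminus θ : ℝ) (h : ℕ → Ω → Fin n → ℝ)
    (μ : Measure Ω) : Prop where
  one_lt_L : 1 < L
  γplus_pos : 0 < γplus
  γminus_pos : 0 < γminus
  θ_nonneg : 0 ≤ θ
  θ_le : θ ≤ 3 * Real.sqrt n
  cov_lower : (covMatrix (h (L - 1)) μ - γminus • (1 : Matrix (Fin n) (Fin n) ℝ)).PosSemidef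
  cov_upper : ∀ t, (γplus • (1 : Matrix (Fin n) (Fin n) ℝ) - covMatrix (h t) μ).PosSemidef
  subgaussian : ∀ t, subgaussianNorm (fun ω => h t ω - meanVec (h t) μ) μ ≤
    ENNReal.ofReal (K * Real.sqrt γplus)
  mean_le : ∀ t, eNorm (meanVec (h t) μ) ≤ θ * Real.sqrt γplus

end Probability

/-- The length `L = ⌈1 - log (c n ρ) / log a⌉`, where `a` is the spectral norm of `A`. -/
def mixingLength (c ρ : ℝ) (n : ℕ) (a : ℝ) : ℕ :=
  ⌈1 - Real.log (c * n * ρ) / Real.log a⌉₊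

/-- The `N` feature vectors `x_t = (s h_t, u_t) ∈ ℝ^{n+p}` for `t = 1, …, N` with scaling `s`;
the index `k : Fin N` stands for the time `t = k + 1`. -/
def feature (s : ℝ) (h : ℕ → Fin n → ℝ) (u : ℕ → Fin p → ℝ) (k : Fin N) : Fin n ⊕ Fin p → ℝ :=
  Sum.elim (s • h (k + 1)) (u (k + 1))

/-- The `N` output vectors `y_t = h_{t+1}` for `t = 1, …, N`, indexed as in `feature`. -/
def output (h : ℕ → Fin n → ℝ) (k : Fin N) : Fin n → ℝ := h (k + 2)

/-- The target parameter `C = [s⁻¹ A, B]`. -/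
def target (s : ℝ) (A : Matrix (Fin n) (Fin n) ℝ) (B : Matrix (Fin n) (Fin p) ℝ) :
    Matrix (Fin n) (Fin n ⊕ Fin p) ℝ :=
  Matrix.fromCols (s⁻¹ • A) B

variable {q : Type*} [Fintype q]

/-- The loss of one sample, `½ ‖y - φ(Θ x)‖²`. -/
def sampleLoss (φ : ℝ → ℝ) (x : q → ℝ) (y : Fin n → ℝ) (Θ : Matrix (Fin n) q ℝ) : ℝ :=
  1 / 2 * ∑ i, (y i - φ ((Θ *ᵥ x) i)) ^ 2

/-- The gradient of `sampleLoss` with respect to `Θ`, by the chain rule with derivative `φ'`. -/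
def sampleGrad (φ φ' : ℝ → ℝ) (x : q → ℝ) (y : Fin n → ℝ) (Θ : Matrix (Fin n) q ℝ) :
    Matrix (Fin n) q ℝ :=
  Matrix.of fun i j => (φ ((Θ *ᵥ x) i) - y i) * φ' ((Θ *ᵥ x) i) * x j

/-- `sampleGrad` is the gradient of the loss wherever `φ` has derivative `φ'` at the entries of
`Θ x`: it represents all directional derivatives. -/
theorem hasDerivAt_sampleLoss (φ φ' : ℝ → ℝ) (x : q → ℝ) (y : Fin n → ℝ)
    (Θ E : Matrix (Fin n) q ℝ)
    (hφ : ∀ i, HasDerivAt φ (φ' ((Θ *ᵥ x) i)) ((Θ *ᵥ x) i)) :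
    HasDerivAt (fun s : ℝ => sampleLoss φ x y (Θ + s • E))
      (∑ i, ∑ j, sampleGrad φ φ' x y Θ i j * E i j) 0 := by
  have hlin : ∀ i, HasDerivAt (fun s : ℝ => ((Θ + s • E) *ᵥ x) i) ((E *ᵥ x) i) 0 := by
    intro i
    have h1 : HasDerivAt (fun s : ℝ => (Θ *ᵥ x) i + s * (E *ᵥ x) i) (1 * (E *ᵥ x) i) 0 :=
      ((hasDerivAt_id (0 : ℝ)).mul_const _).const_add _
    rw [one_mul] at h1
    refine h1.congr_of_eventuallyEq (Filter.Eventually.of_forall fun s => ?_)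
    simp [Matrix.add_mulVec, Matrix.smul_mulVec]
  have hterm : ∀ i, HasDerivAt (fun s : ℝ => (y i - φ (((Θ + s • E) *ᵥ x) i)) ^ 2)
      (2 * (∑ j, sampleGrad φ φ' x y Θ i j * E i j)) 0 := by
    intro i
    have h0 : ((Θ + (0 : ℝ) • E) *ᵥ x) i = (Θ *ᵥ x) i := by simp
    have h2 : HasDerivAt φ (φ' ((Θ *ᵥ x) i)) (((Θ + (0 : ℝ) • E) *ᵥ x) i) := by
      rw [h0]; exact hφ i
    have h3 := ((h2.comp (0 : ℝ) (hlin i)).const_sub (y i)).pow 2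
    refine h3.congr_deriv ?_
    have h4 : ∑ j, sampleGrad φ φ' x y Θ i j * E i j
        = (φ ((Θ *ᵥ x) i) - y i) * φ' ((Θ *ᵥ x) i) * (E *ᵥ x) i := by
      simp only [sampleGrad, Matrix.of_apply, Matrix.mulVec, dotProduct, Finset.mul_sum]
      exact Finset.sum_congr rfl fun j _ => by ring
    rw [h4]
    simp
    ring
  have hsum := (HasDerivAt.fun_sum (u := Finset.univ) fun i _ => hterm i).const_mul (1 / 2 : ℝ)
  refine hsum.congr_deriv ?_
  rw [← Finset.mul_sum]
  ring

/-- The SGD iterate `Θ_τ` with learning rate `η` from the initial point `Θ₀`, when the samples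
chosen in the steps `1, …, τ` are `r 0, …, r (τ - 1)`. -/
def sgd (φ φ' : ℝ → ℝ) (x : Fin N → q → ℝ) (y : Fin N → Fin n → ℝ) (η : ℝ)
    (Θ₀ : Matrix (Fin n) q ℝ) : (τ : ℕ) → (Fin τ → Fin N) → Matrix (Fin n) q ℝ
  | 0, _ => Θ₀
  | τ + 1, r =>
    let Θ := sgd φ φ' x y η Θ₀ τ (Fin.init r)
    let k := r (Fin.last τ)
    Θ - η • sampleGrad φ φ' (x k) (y k) Θ

/-- `E ‖Θ_τ - M‖_F²` over the randomness of the SGD updates: the sample indices are independent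
and uniform, i.e. the index sequence is uniform on `(Fin N)^τ`. -/
def sgdError (φ φ' : ℝ → ℝ) (x : Fin N → q → ℝ) (y : Fin N → Fin n → ℝ) (η : ℝ)
    (Θ₀ M : Matrix (Fin n) q ℝ) (τ : ℕ) : ℝ :=
  𝔼 r : Fin τ → Fin N, frobSq (sgd φ φ' x y η Θ₀ τ r - M)

end

end RNN

open RNN

namespace RNN

/-! The proof separates a deterministic contraction from a statement about the trajectory.

Contraction. Chord slopes of `φ` lie in `[β, 1]`, so on each row the gradient is that of a linear
regression damped by a factor in `[β², 1]`. If `η ‖x_t‖² ≤ 1` for all samples and `∑ (v ⬝ᵥ x_t)² ≥ N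
l ‖v‖²` for all `v`, each step multiplies the expected squared error by at most `1 - η β² l`
(`sgdError_le`). The activation need not be smooth, and the bound covers all initial points and
times at once.

Trajectory. It remains to find an event on which the features have norm of order at most `(θ + √2)
√(n + p)` and the bound holds with `l = 1 / (2ρ)`. Norms are controlled by subgaussian tails and a
net. For the lower bound the states are dependent, so each state is replaced by the state restarted
from zero `L - 1` steps earlier. Since `φ` is 1-Lipschitz and `‖A‖ < 1`, the error is at most
`‖A‖^(L-1)` times the norm of the old state, and the choice of `L` makes it negligible. Restarted
samples whose times are congruent modulo `L` use disjoint input windows, hence are i.i.d.; Bernstein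
bounds, a net, and a union over the `L` residue classes give uniform concentration
(`measure_exists_quadForm_gt_le`, `sum_sq_feature_ge`).

The state mean may be large. `centeredSample` therefore carries a centered state, the input and a
constant coordinate 1; the mean enters only through the coefficient `d` of that coordinate. The
second moment is at least `d²` there, against a deviation of order `d² / ρ`, so `θ` does not enter
the required sample size. -/

theorem IsBetaIncreasing.mul_sub_le {β : ℝ} {φ φ' : ℝ → ℝ} (h : IsBetaIncreasing β φ φ') {a b : ℝ}
    (hab : a ≤ b) : β * (b - a) ≤ φ b - φ a := by
  -- A Lipschitz function is absolutely continuous, so its increment is the integral of its a.e.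
  -- derivative; the arbitrary values of `φ'` at kinks lie on a null set.
  have hac : AbsolutelyContinuousOnInterval φ a b :=
    (h.lipschitz.lipschitzOnWith).absolutelyContinuousOnInterval
  rw [← hac.integral_deriv_eq_sub]
  have hc : ∫ _ in a..b, β = β * (b - a) := by simp [mul_comm]
  rw [← hc]
  refine intervalIntegral.integral_mono_ae hab (by simp) hac.intervalIntegrable_deriv ?_
  filter_upwards [h.lipschitz.ae_differentiableAt_real] with x hx
  rw [← h.eq_deriv x hx]
  exact h.beta_le x

theorem IsBetaIncreasing.exists_slope {β : ℝ} {φ φ' : ℝ → ℝ} (h : IsBetaIncreasing β φ φ')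
    (a b : ℝ) : ∃ d, β ≤ d ∧ d ≤ 1 ∧ φ b - φ a = d * (b - a) := by
  have key : ∀ a b, a < b → ∃ d, β ≤ d ∧ d ≤ 1 ∧ φ b - φ a = d * (b - a) := by
    intro a b hab
    have hpos : 0 < b - a := sub_pos.2 hab
    have hup : φ b - φ a ≤ b - a := by
      have := h.lipschitz.dist_le_mul b a
      rw [Real.dist_eq, Real.dist_eq, abs_of_pos hpos] at this
      simpa using (le_abs_self _).trans this
    refine ⟨(φ b - φ a) / (b - a), ?_, ?_, ?_⟩
    · rw [le_div_iff₀ hpos]; exact h.mul_sub_le hab.le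
    · rw [div_le_one hpos]; exact hup
    · field_simp
  rcases lt_trichotomy a b with hab | rfl | hab
  · exact key a b hab
  · exact ⟨1, h.beta_le_one, le_rfl, by simp⟩
  · obtain ⟨d, h1, h2, h3⟩ := key b a hab
    exact ⟨d, h1, h2, by linarith⟩

/-! ### Contraction of SGD -/

section

variable {n N : ℕ} {q : Type*} [Fintype q]

/-- Row by row, with `y` the row's linear error, the gradient is `w y x` where `w = d f` is a chord
slope times a derivative value, so `β² ≤ w ≤ 1`. The cross term gains `2 η w y²`, and the quadratic
term costs at most `η w y²`. -/
theorem frobSq_sgd_step_le {β : ℝ} {φ φ' : ℝ → ℝ} (h : IsBetaIncreasing β φ φ') (x : q → ℝ)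
    (Θ M : Matrix (Fin n) q ℝ) {η : ℝ} (hη : 0 ≤ η) (hx : η * ∑ j, x j ^ 2 ≤ 1) :
    frobSq (Θ - η • sampleGrad φ φ' x (fun i => φ ((M *ᵥ x) i)) Θ - M) ≤
      frobSq (Θ - M) - η * β ^ 2 * ∑ i, ((Θ - M) *ᵥ x) i ^ 2 := by
  rw [frobSq, frobSq, Finset.mul_sum, ← Finset.sum_sub_distrib]
  refine Finset.sum_le_sum fun i _ => ?_
  obtain ⟨d, hd1, hd2, hd⟩ := h.exists_slope ((M *ᵥ x) i) ((Θ *ᵥ x) i)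
  set f := φ' ((Θ *ᵥ x) i) with hf
  have hf1 : β ≤ f := h.beta_le _
  have hf2 : f ≤ 1 := h.le_one _
  set y := ((Θ - M) *ᵥ x) i with hy
  have hy' : y = (Θ *ᵥ x) i - (M *ᵥ x) i := by rw [hy, Matrix.sub_mulVec]; rfl
  have hy2 : y = ∑ j, (Θ - M) i j * x j := rfl
  have hexp : ∑ j, (Θ - η • sampleGrad φ φ' x (fun i => φ ((M *ᵥ x) i)) Θ - M) i j ^ 2
      = ∑ j, (Θ - M) i j ^ 2 - 2 * η * (d * f * y) * y + η ^ 2 * (d * f * y) ^ 2 * ∑ j, x j ^ 2 := by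
    have h5 : 2 * η * (d * f * y) * y = ∑ j, 2 * η * (d * f * y) * ((Θ - M) i j * x j) := by
      rw [← Finset.mul_sum, ← hy2]
    rw [h5, Finset.mul_sum, ← Finset.sum_sub_distrib, ← Finset.sum_add_distrib]
    refine Finset.sum_congr rfl fun j _ => ?_
    simp only [Matrix.sub_apply, Matrix.smul_apply, sampleGrad, Matrix.of_apply, smul_eq_mul]
    rw [hd, ← hy', ← hf]
    ring
  rw [hexp]
  have hβ := h.beta_nonneg
  have hw1 : β ^ 2 ≤ d * f := by
    rw [sq]; exact mul_le_mul hd1 hf1 hβ (hβ.trans hd1)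
  have hw0 : 0 ≤ d * f := (sq_nonneg β).trans hw1
  have hw2 : d * f ≤ 1 := mul_le_one₀ hd2 (hβ.trans hf1) hf2
  set w := d * f
  -- The step-size condition absorbs one factor `η ‖x‖²`; then `w² ≤ w` leaves half of the cross
  -- term.
  have e1 : η ^ 2 * (w * y) ^ 2 * ∑ j, x j ^ 2 ≤ η * (w * y) ^ 2 := by
    have := mul_le_mul_of_nonneg_left hx (by positivity : 0 ≤ η * (w * y) ^ 2)
    nlinarith [this]
  have e2 : η * (w * y) ^ 2 ≤ η * w * y ^ 2 := by
    have : w ^ 2 ≤ w := by nlinarith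
    have := mul_le_mul_of_nonneg_left this (by positivity : 0 ≤ η * y ^ 2)
    nlinarith [this]
  have e3 : η * β ^ 2 * y ^ 2 ≤ η * w * y ^ 2 := by gcongr
  nlinarith [e1, e2, e3]

/-- Conditioning on the first `τ` indices, in counting form: the last index is split off by
`Fin.snoc`. -/
theorem sgdError_succ (φ φ' : ℝ → ℝ) (x : Fin N → q → ℝ) (y : Fin N → Fin n → ℝ) (η : ℝ)
    (Θ₀ M : Matrix (Fin n) q ℝ) (τ : ℕ) :
    sgdError φ φ' x y η Θ₀ M (τ + 1) = (∑ r : Fin τ → Fin N, ∑ k : Fin N,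
      frobSq (sgd φ φ' x y η Θ₀ τ r -
        η • sampleGrad φ φ' (x k) (y k) (sgd φ φ' x y η Θ₀ τ r) - M)) / (N ^ τ * N) := by
  rw [sgdError, Fintype.expect_eq_sum_div_card]
  congr 1
  · rw [← (Fin.snocEquiv fun _ : Fin (τ + 1) => Fin N).sum_comp, Fintype.sum_prod_type_right]
    refine Finset.sum_congr rfl fun r _ => Finset.sum_congr rfl fun k _ => ?_
    simp [Fin.snocEquiv, sgd]
  · simp [pow_succ]

/-- Averaging the one-step bound over the sample turns its gain into the empirical quadratic form at
the rows of `Θ - M`, to which `hl` applies. -/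
theorem sgdError_le {β : ℝ} {φ φ' : ℝ → ℝ} (h : IsBetaIncreasing β φ φ') (hN : 0 < N)
    (x : Fin N → q → ℝ) (Θ₀ M : Matrix (Fin n) q ℝ) {η : ℝ} (hη : 0 ≤ η)
    (hx : ∀ k, η * ∑ j, x k j ^ 2 ≤ 1) {l : ℝ}
    (hl : ∀ v : q → ℝ, N * l * ∑ j, v j ^ 2 ≤ ∑ k, (v ⬝ᵥ x k) ^ 2) (hq : 0 ≤ 1 - η * β ^ 2 * l)
    (τ : ℕ) :
    sgdError φ φ' x (fun k i => φ ((M *ᵥ x k) i)) η Θ₀ M τ ≤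
      (1 - η * β ^ 2 * l) ^ τ * frobSq (Θ₀ - M) := by
  induction τ with
  | zero => simp [sgdError, sgd]
  | succ τ ih =>
    have hNr : (0 : ℝ) < N := by exact_mod_cast hN
    have hstep : ∀ Θ : Matrix (Fin n) q ℝ, ∑ k : Fin N,
        frobSq (Θ - η • sampleGrad φ φ' (x k) (fun i => φ ((M *ᵥ x k) i)) Θ - M) ≤
        N * ((1 - η * β ^ 2 * l) * frobSq (Θ - M)) := by
      intro Θ
      refine (Finset.sum_le_sum fun k _ => frobSq_sgd_step_le h (x k) Θ M hη (hx k)).trans ?_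
      rw [Finset.sum_sub_distrib, ← Finset.mul_sum, Finset.sum_comm]
      have h2 : N * l * frobSq (Θ - M) ≤ ∑ i, ∑ k, ((Θ - M) *ᵥ x k) i ^ 2 := by
        rw [frobSq, Finset.mul_sum]
        exact Finset.sum_le_sum fun i _ => hl ((Θ - M) i)
      have h3 := mul_le_mul_of_nonneg_left h2 (by positivity : 0 ≤ η * β ^ 2)
      simp only [Finset.sum_const, Finset.card_univ, Fintype.card_fin, nsmul_eq_mul]
      nlinarith [h3]
    rw [sgdError_succ, div_le_iff₀ (by positivity)]
    refine (Finset.sum_le_sum fun r _ => hstep _).trans ?_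
    rw [← Finset.mul_sum, ← Finset.mul_sum]
    have ih' := ih
    rw [sgdError, Fintype.expect_eq_sum_div_card, div_le_iff₀ (by simp; positivity)] at ih'
    have h4 := mul_le_mul_of_nonneg_left ih' (mul_nonneg hNr.le hq)
    simp only [Fintype.card_pi, Fintype.card_fin, Finset.prod_const, Finset.card_univ] at h4
    push_cast at h4
    calc _ = N * (1 - η * β ^ 2 * l) * ∑ i : Fin τ → Fin N, frobSq
            (sgd φ φ' x (fun k i => φ ((M *ᵥ x k) i)) η Θ₀ τ i - M) := by ring
      _ ≤ _ := h4
      _ = _ := by ring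

end

/-! ### Euclidean norm of plain vectors -/

section

variable {ι κ : Type*} [Fintype ι] [Fintype κ]

theorem eNorm_nonneg (x : ι → ℝ) : 0 ≤ eNorm x := Real.sqrt_nonneg _

theorem eNorm_sq (x : ι → ℝ) : eNorm x ^ 2 = ∑ i, x i ^ 2 :=
  Real.sq_sqrt (Finset.sum_nonneg fun _ _ => sq_nonneg _)

theorem eNorm_sq_eq_dotProduct (x : ι → ℝ) : eNorm x ^ 2 = x ⬝ᵥ x := by
  rw [eNorm_sq, dotProduct]
  exact Finset.sum_congr rfl fun i _ => sq _

theorem norm_toLp_eq_eNorm (x : ι → ℝ) : ‖WithLp.toLp 2 x‖ = eNorm x := by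
  simp [EuclideanSpace.norm_eq, eNorm]

theorem eNorm_add_le (x y : ι → ℝ) : eNorm (x + y) ≤ eNorm x + eNorm y := by
  simpa only [← norm_toLp_eq_eNorm, WithLp.toLp_add] using norm_add_le _ _

theorem eNorm_sub_le (x y : ι → ℝ) : eNorm (x - y) ≤ eNorm x + eNorm y := by
  simpa only [← norm_toLp_eq_eNorm, WithLp.toLp_sub] using norm_sub_le _ _

theorem eNorm_smul (c : ℝ) (x : ι → ℝ) : eNorm (c • x) = |c| * eNorm x := by
  simpa only [← norm_toLp_eq_eNorm, WithLp.toLp_smul, Real.norm_eq_abs] using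
    norm_smul c (WithLp.toLp 2 x)

theorem eNorm_eq_zero {x : ι → ℝ} (h : eNorm x = 0) : x = 0 := by
  rw [← norm_toLp_eq_eNorm, norm_eq_zero] at h
  simpa using h

theorem abs_dotProduct_le (x y : ι → ℝ) : |x ⬝ᵥ y| ≤ eNorm x * eNorm y := by
  have h := abs_real_inner_le_norm (WithLp.toLp 2 x) (WithLp.toLp 2 y)
  rwa [norm_toLp_eq_eNorm, norm_toLp_eq_eNorm, EuclideanSpace.inner_toLp_toLp, dotProduct_comm,
    star_trivial] at h

theorem eNorm_mono {x y : ι → ℝ} (h : ∀ i, |x i| ≤ |y i|) : eNorm x ≤ eNorm y :=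
  Real.sqrt_le_sqrt (Finset.sum_le_sum fun i _ => sq_le_sq.2 (h i))

theorem eNorm_mulVec_le {n : ℕ} (A : Matrix (Fin n) (Fin n) ℝ) (x : Fin n → ℝ) :
    eNorm (A *ᵥ x) ≤ ‖A‖ * eNorm x := by
  have h := A.l2_opNorm_mulVec (WithLp.toLp 2 x)
  rw [norm_toLp_eq_eNorm x] at h
  rw [← norm_toLp_eq_eNorm (A *ᵥ x)]
  exact h

theorem eNorm_sumElim_sq (x : ι → ℝ) (y : κ → ℝ) :
    eNorm (Sum.elim x y) ^ 2 = eNorm x ^ 2 + eNorm y ^ 2 := by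
  simp [eNorm_sq]

theorem continuous_eNorm : Continuous (eNorm : (ι → ℝ) → ℝ) := by
  unfold eNorm; fun_prop

theorem isCompact_eNorm_le_one : IsCompact {x : ι → ℝ | eNorm x ≤ 1} := by
  refine Metric.isCompact_of_isClosed_isBounded
    (isClosed_le continuous_eNorm continuous_const) ?_
  refine (Metric.isBounded_closedBall (x := (0 : ι → ℝ)) (r := 1)).subset fun x hx => ?_
  rw [mem_closedBall_zero_iff, pi_norm_le_iff_of_nonneg zero_le_one]
  intro i
  have h1 : x i ^ 2 ≤ eNorm x ^ 2 := by
    rw [eNorm_sq]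
    exact Finset.single_le_sum (f := fun i => x i ^ 2) (fun _ _ => sq_nonneg _) (Finset.mem_univ i)
  exact (abs_le_of_sq_le_sq h1 (eNorm_nonneg x)).trans hx

end

/-! ### Nets of the unit ball -/

section

variable (E : Type*) [NormedAddCommGroup E] [NormedSpace ℝ E] [FiniteDimensional ℝ E]

/-- A maximal 1-separated set in the ball of radius 2 is a 1-net of that ball, and the Besicovitch
packing bound limits its size. Halving it gives the net. -/
theorem exists_half_net : ∃ T : Finset E, T.card ≤ 5 ^ Module.finrank ℝ E ∧
    (∀ v ∈ T, ‖v‖ ≤ 1) ∧ ∀ w : E, ‖w‖ ≤ 1 → ∃ v ∈ T, ‖w - v‖ ≤ 1 / 2 := by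
  classical
  let S : Set ℕ := {k | ∃ s : Finset E, s.card = k ∧ (∀ c ∈ s, ‖c‖ ≤ 2) ∧
    ∀ c ∈ s, ∀ d ∈ s, c ≠ d → 1 ≤ ‖c - d‖}
  have hne : S.Nonempty := ⟨0, ∅, by simp⟩
  have hbdd : BddAbove S := by
    refine ⟨5 ^ Module.finrank ℝ E, ?_⟩
    rintro _ ⟨s, rfl, h1, h2⟩
    exact Besicovitch.card_le_of_separated s h1 h2
  obtain ⟨s, hs, h1, h2⟩ := Nat.sSup_mem hne hbdd
  have hcov : ∀ w : E, ‖w‖ ≤ 2 → ∃ c ∈ s, ‖w - c‖ ≤ 1 := by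
    intro w hw
    by_contra! hcon
    have hws : w ∉ s := fun h => by
      have := hcon w h
      norm_num at this
    have hmem : s.card + 1 ∈ S := by
      refine ⟨insert w s, Finset.card_insert_of_notMem hws, ?_, ?_⟩
      · intro c hc
        rcases Finset.mem_insert.1 hc with rfl | hc
        exacts [hw, h1 c hc]
      · intro c hc d hd hcd
        rcases Finset.mem_insert.1 hc with hc | hc <;>
          rcases Finset.mem_insert.1 hd with hd | hd
        · exact absurd (hc.trans hd.symm) hcd
        · rw [hc]; exact (hcon d hd).le
        · rw [hd, norm_sub_rev]; exact (hcon c hc).le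
        · exact h2 c hc d hd hcd
    have := le_csSup hbdd hmem
    omega
  refine ⟨s.image fun c => (1 / 2 : ℝ) • c, ?_, ?_, ?_⟩
  · exact Finset.card_image_le.trans (Besicovitch.card_le_of_separated s h1 h2)
  · intro v hv
    obtain ⟨c, hc, rfl⟩ := Finset.mem_image.1 hv
    rw [norm_smul]
    have := h1 c hc
    norm_num
    linarith
  · intro w hw
    obtain ⟨c, hc, hwc⟩ := hcov ((2 : ℝ) • w) (by rw [norm_smul]; norm_num; linarith)
    refine ⟨_, Finset.mem_image_of_mem _ hc, ?_⟩
    have : w - (1 / 2 : ℝ) • c = (1 / 2 : ℝ) • ((2 : ℝ) • w - c) := by module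
    rw [this, norm_smul]
    norm_num
    linarith

end

section

variable {ι : Type*} [Fintype ι]

variable (ι) in
/-- A quarter-net of the Euclidean unit ball, inside the ball of radius two. -/
theorem exists_quarter_net : ∃ T : Finset (ι → ℝ), T.card ≤ 25 ^ Fintype.card ι ∧
    (∀ v ∈ T, eNorm v ≤ 2) ∧ ∀ w : ι → ℝ, eNorm w ≤ 1 → ∃ v ∈ T, eNorm (w - v) ≤ 1 / 4 := by
  classical
  obtain ⟨T, hcard, h1, h2⟩ := exists_half_net (EuclideanSpace ℝ ι)
  rw [finrank_euclideanSpace] at hcard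
  -- Two-scale approximation: twice the residual of the first half-net point is again in the unit
  -- ball and is approximated by a second one.
  refine ⟨(T ×ˢ T).image fun z => z.1.ofLp + (1 / 2 : ℝ) • z.2.ofLp, ?_, ?_, ?_⟩
  · refine Finset.card_image_le.trans ?_
    rw [Finset.card_product, show 25 = 5 * 5 from rfl, mul_pow]
    exact Nat.mul_le_mul hcard hcard
  · intro v hv
    obtain ⟨⟨c, d⟩, hcd, rfl⟩ := Finset.mem_image.1 hv
    rw [Finset.mem_product] at hcd
    refine (eNorm_add_le _ _).trans ?_
    rw [eNorm_smul, ← norm_toLp_eq_eNorm, ← norm_toLp_eq_eNorm]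
    have e1 := h1 c hcd.1
    have e2 := h1 d hcd.2
    simp only [WithLp.toLp_ofLp]
    rw [abs_of_pos (by norm_num)]
    linarith
  · intro w hw
    rw [← norm_toLp_eq_eNorm] at hw
    obtain ⟨c, hc, hwc⟩ := h2 _ hw
    obtain ⟨d, hd, hwd⟩ := h2 ((2 : ℝ) • (WithLp.toLp 2 w - c))
      (by rw [norm_smul]; norm_num; linarith)
    refine ⟨_, Finset.mem_image_of_mem _ (Finset.mk_mem_product hc hd), ?_⟩
    have e : WithLp.toLp 2 (w - (c.ofLp + (1 / 2 : ℝ) • d.ofLp)) =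
        (1 / 2 : ℝ) • ((2 : ℝ) • (WithLp.toLp 2 w - c) - d) := by
      ext i
      simp
      ring
    rw [← norm_toLp_eq_eNorm, e, norm_smul, Real.norm_eq_abs, abs_of_pos (by norm_num)]
    linarith

theorem eNorm_le_of_net {T : Finset (ι → ℝ)}
    (hT : ∀ w : ι → ℝ, eNorm w ≤ 1 → ∃ v ∈ T, eNorm (w - v) ≤ 1 / 4) {x : ι → ℝ} {r : ℝ}
    (hx : ∀ v ∈ T, |v ⬝ᵥ x| ≤ r) : eNorm x ≤ 2 * r := by
  by_cases h0 : eNorm x = 0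
  · obtain ⟨v, hv, -⟩ := hT 0 (by simp [eNorm])
    have := (abs_nonneg _).trans (hx v hv)
    linarith
  have hpos : 0 < eNorm x := lt_of_le_of_ne (eNorm_nonneg x) (Ne.symm h0)
  obtain ⟨v, hv, hvw⟩ := hT ((eNorm x)⁻¹ • x) (by
    rw [eNorm_smul, abs_of_pos (inv_pos.2 hpos), inv_mul_cancel₀ h0])
  have e1 : ((eNorm x)⁻¹ • x) ⬝ᵥ x = eNorm x := by
    rw [smul_dotProduct, ← eNorm_sq_eq_dotProduct, smul_eq_mul]
    field_simp
  have e2 := abs_dotProduct_le ((eNorm x)⁻¹ • x - v) x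
  have e3 : ((eNorm x)⁻¹ • x - v) ⬝ᵥ x = eNorm x - v ⬝ᵥ x := by rw [sub_dotProduct, e1]
  rw [e3] at e2
  have e4 := mul_le_mul_of_nonneg_right hvw hpos.le
  have e5 := le_abs_self (eNorm x - v ⬝ᵥ x)
  have e6 := (le_abs_self _).trans (hx v hv)
  linarith

/-- A quadratic form that is small on a quarter-net is small on the unit ball. -/
theorem abs_quadForm_le_of_net {T : Finset (ι → ℝ)}
    (hT : ∀ w : ι → ℝ, eNorm w ≤ 1 → ∃ v ∈ T, eNorm (w - v) ≤ 1 / 4) {M : Matrix ι ι ℝ}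
    (hM : M.IsSymm) {δ : ℝ} (hδ : ∀ v ∈ T, |v ⬝ᵥ M *ᵥ v| ≤ δ) (w : ι → ℝ) :
    |w ⬝ᵥ M *ᵥ w| ≤ 3 * δ * eNorm w ^ 2 := by
  have hcont : Continuous fun w : ι → ℝ => |w ⬝ᵥ M *ᵥ w| := by fun_prop
  -- Compactness provides a maximizer of the form, which is then compared with a nearby net point.
  obtain ⟨w₀, hw₀, hmax⟩ := isCompact_eNorm_le_one.exists_isMaxOn
    ⟨(0 : ι → ℝ), by simp [eNorm]⟩ hcont.continuousOn
  set s := |w₀ ⬝ᵥ M *ᵥ w₀| with hs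
  have hhom : ∀ w : ι → ℝ, |w ⬝ᵥ M *ᵥ w| ≤ s * eNorm w ^ 2 := by
    intro w
    by_cases h0 : eNorm w = 0
    · rw [eNorm_eq_zero h0]; simp [eNorm]
    have hpos : 0 < eNorm w := lt_of_le_of_ne (eNorm_nonneg w) (Ne.symm h0)
    have h1 := hmax (show (eNorm w)⁻¹ • w ∈ {x : ι → ℝ | eNorm x ≤ 1} by
      simp only [Set.mem_ofPred_eq]
      rw [eNorm_smul, abs_of_pos (inv_pos.2 hpos), inv_mul_cancel₀ h0])
    simp only [Set.mem_ofPred_eq, Matrix.mulVec_smul, smul_dotProduct, dotProduct_smul, smul_eq_mul,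
      abs_mul] at h1
    rw [abs_of_pos (inv_pos.2 hpos)] at h1
    have h2 : (eNorm w)⁻¹ * ((eNorm w)⁻¹ * |w ⬝ᵥ M *ᵥ w|) = |w ⬝ᵥ M *ᵥ w| / eNorm w ^ 2 := by
      field_simp
    rw [h2, div_le_iff₀ (by positivity)] at h1
    exact h1
  have hsymm : ∀ x y : ι → ℝ, x ⬝ᵥ M *ᵥ y = y ⬝ᵥ M *ᵥ x := by
    intro x y
    rw [Matrix.dotProduct_mulVec, ← Matrix.mulVec_transpose, hM.eq, dotProduct_comm]
  obtain ⟨v, hv, hvw⟩ := hT w₀ hw₀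
  set x := w₀ - v with hx
  set y := w₀ + v with hy
  have hyn : eNorm y ≤ 9 / 4 := by
    have : y = (2 : ℝ) • w₀ - x := by rw [hx, hy]; module
    rw [this]
    refine (eNorm_sub_le _ _).trans ?_
    rw [eNorm_smul, abs_of_pos (by norm_num)]
    have : eNorm w₀ ≤ 1 := hw₀
    linarith
  have hQ : w₀ ⬝ᵥ M *ᵥ w₀ - v ⬝ᵥ M *ᵥ v = x ⬝ᵥ M *ᵥ y := by
    rw [hx, hy]
    simp only [Matrix.mulVec_add, sub_dotProduct, dotProduct_add]
    rw [hsymm v w₀]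
    ring
  -- The weight 9 balances the norm bounds `1/4` for `x` and `9/4` for `y`. Polarization then bounds
  -- the bilinear term by `9/16 * s`, so `s ≤ 16/7 * δ ≤ 3 * δ`.
  have hpol : 36 * (x ⬝ᵥ M *ᵥ y) = ((9 : ℝ) • x + y) ⬝ᵥ M *ᵥ ((9 : ℝ) • x + y)
      - ((9 : ℝ) • x - y) ⬝ᵥ M *ᵥ ((9 : ℝ) • x - y) := by
    simp only [Matrix.mulVec_add, Matrix.mulVec_sub, Matrix.mulVec_smul, sub_dotProduct,
      add_dotProduct, dotProduct_add, dotProduct_sub, smul_dotProduct, dotProduct_smul, smul_eq_mul]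
    rw [hsymm y x]
    ring
  have hpar : eNorm ((9 : ℝ) • x + y) ^ 2 + eNorm ((9 : ℝ) • x - y) ^ 2
      = 162 * eNorm x ^ 2 + 2 * eNorm y ^ 2 := by
    simp only [eNorm_sq, Finset.mul_sum, ← Finset.sum_add_distrib]
    refine Finset.sum_congr rfl fun i _ => ?_
    simp only [Pi.add_apply, Pi.sub_apply, Pi.smul_apply, smul_eq_mul]
    ring
  have hs0 : 0 ≤ s := abs_nonneg _
  have hx2 : eNorm x ^ 2 ≤ (1 / 4) ^ 2 := by gcongr; exact eNorm_nonneg x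
  have hy2 : eNorm y ^ 2 ≤ (9 / 4) ^ 2 := by gcongr; exact eNorm_nonneg y
  have h36 : |36 * (x ⬝ᵥ M *ᵥ y)| ≤ s * (81 / 4) := by
    rw [hpol]
    refine (abs_sub _ _).trans ((add_le_add (hhom _) (hhom _)).trans ?_)
    rw [← mul_add, hpar]
    exact mul_le_mul_of_nonneg_left (by linarith) hs0
  rw [abs_mul, abs_of_pos (by norm_num : (0 : ℝ) < 36), ← hQ] at h36
  have h5 := abs_sub_abs_le_abs_sub (w₀ ⬝ᵥ M *ᵥ w₀) (v ⬝ᵥ M *ᵥ v)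
  have h6 := hδ v hv
  have h7 : s ≤ 3 * δ := by linarith
  exact (hhom w).trans (by gcongr)

end

/-! ### Exponential moments of squares and concentration -/

section

variable {Ω : Type*} [MeasurableSpace Ω]

/-- The square of `Y` has exponential moment at most two at `a`. -/
def ExpSqBounded (a : ℝ) (Y : Ω → ℝ) (P : Measure Ω) : Prop :=
  ∫⁻ ω, ENNReal.ofReal (Real.exp (a * Y ω ^ 2)) ∂P ≤ 2

variable {P : Measure Ω} {a : ℝ} {X Y Z : Ω → ℝ}

theorem ExpSqBounded.mono {a' : ℝ} (h : ExpSqBounded a Y P) (hle : ∀ ω, a' * X ω ^ 2 ≤ a * Y ω ^ 2) :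
    ExpSqBounded a' X P :=
  (lintegral_mono fun ω => ENNReal.ofReal_le_ofReal (Real.exp_le_exp.2 (hle ω))).trans h

theorem expSqBounded_const [IsProbabilityMeasure P] {c : ℝ} (h : a * c ^ 2 ≤ 1 / 2) :
    ExpSqBounded a (fun _ => c) P := by
  have h2 : Real.exp (a * c ^ 2) ≤ 2 := by
    refine (Real.exp_le_exp.2 h).trans ?_
    have := Real.exp_bound_div_one_sub_of_interval (x := 1 / 2) (by norm_num) (by norm_num)
    norm_num at this ⊢
    exact this
  rw [ExpSqBounded, lintegral_const, measure_univ, mul_one]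
  calc _ ≤ ENNReal.ofReal 2 := ENNReal.ofReal_le_ofReal h2
    _ = 2 := by norm_num

/-- Convexity of the square and the AM-GM inequality for three exponentials; no independence is
needed. -/
theorem ExpSqBounded.add_add (hX : Measurable X) (hY : Measurable Y)
    (ha : 0 ≤ a) (h1 : ExpSqBounded a X P)
    (h2 : ExpSqBounded a Y P) (h3 : ExpSqBounded a Z P) :
    ExpSqBounded (a / 9) (fun ω => X ω + Y ω + Z ω) P := by
  have hpt : ∀ x y z : ℝ, Real.exp (a / 9 * (x + y + z) ^ 2) ≤
      1 / 3 * (Real.exp (a * x ^ 2) + Real.exp (a * y ^ 2) + Real.exp (a * z ^ 2)) := by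
    intro x y z
    have e1 : a / 9 * (x + y + z) ^ 2 ≤ a * x ^ 2 / 3 + a * y ^ 2 / 3 + a * z ^ 2 / 3 := by
      have : 0 ≤ a / 9 * ((x - y) ^ 2 + (y - z) ^ 2 + (x - z) ^ 2) := by positivity
      nlinarith [this]
    refine (Real.exp_le_exp.2 e1).trans ?_
    rw [Real.exp_add, Real.exp_add]
    have e2 : ∀ r, Real.exp r = Real.exp (r / 3) ^ 3 := fun r => by
      rw [← Real.exp_nat_mul]; congr 1; push_cast; ring
    rw [e2 (a * x ^ 2), e2 (a * y ^ 2), e2 (a * z ^ 2)]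
    have p1 := Real.exp_pos (a * x ^ 2 / 3)
    have p2 := Real.exp_pos (a * y ^ 2 / 3)
    have p3 := Real.exp_pos (a * z ^ 2 / 3)
    generalize Real.exp (a * x ^ 2 / 3) = u at *
    generalize Real.exp (a * y ^ 2 / 3) = v at *
    generalize Real.exp (a * z ^ 2 / 3) = w at *
    nlinarith [mul_nonneg (add_pos (add_pos p1 p2) p3).le (sq_nonneg (u - v)),
      mul_nonneg (add_pos (add_pos p1 p2) p3).le (sq_nonneg (v - w)),
      mul_nonneg (add_pos (add_pos p1 p2) p3).le (sq_nonneg (u - w))]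
  unfold ExpSqBounded at *
  calc _ ≤ ∫⁻ ω, ENNReal.ofReal (1 / 3) * (ENNReal.ofReal (Real.exp (a * X ω ^ 2)) +
        ENNReal.ofReal (Real.exp (a * Y ω ^ 2)) + ENNReal.ofReal (Real.exp (a * Z ω ^ 2))) ∂P := by
        refine lintegral_mono fun ω => ?_
        rw [← ENNReal.ofReal_add (Real.exp_pos _).le (Real.exp_pos _).le,
          ← ENNReal.ofReal_add (by positivity) (Real.exp_pos _).le,
          ← ENNReal.ofReal_mul (by norm_num)]
        exact ENNReal.ofReal_le_ofReal (hpt _ _ _)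
    _ ≤ ENNReal.ofReal (1 / 3) * (2 + 2 + 2) := by
        rw [lintegral_const_mul' _ _ ENNReal.ofReal_ne_top, lintegral_add_left (by fun_prop),
          lintegral_add_left (by fun_prop)]
        gcongr
    _ = 2 := by
        rw [show (2 + 2 + 2 : ENNReal) = ENNReal.ofReal 6 by norm_num,
          ← ENNReal.ofReal_mul (by norm_num)]
        norm_num

theorem ExpSqBounded.integrable_exp [IsFiniteMeasure P] (hY : Measurable Y) (h : ExpSqBounded a Y P)
    {t : ℝ} (ht : t ≤ a) : Integrable (fun ω => Real.exp (t * Y ω ^ 2)) P := by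
  refine ⟨by fun_prop, ?_⟩
  rw [hasFiniteIntegral_iff_ofReal (Filter.Eventually.of_forall fun _ => (Real.exp_pos _).le)]
  have h' : ExpSqBounded t Y P :=
    h.mono fun ω => mul_le_mul_of_nonneg_right ht (sq_nonneg _)
  exact lt_of_le_of_lt h' (by norm_num)

theorem ExpSqBounded.integral_exp_le [IsFiniteMeasure P] (hY : Measurable Y)
    (h : ExpSqBounded a Y P) : ∫ ω, Real.exp (a * Y ω ^ 2) ∂P ≤ 2 := by
  rw [integral_eq_lintegral_of_nonneg_ae
    (Filter.Eventually.of_forall fun _ => (Real.exp_pos _).le) (by fun_prop)]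
  have := ENNReal.toReal_mono (by norm_num) h
  simpa using this

theorem ExpSqBounded.integrable_sq [IsFiniteMeasure P] (hY : Measurable Y) (ha : 0 < a)
    (h : ExpSqBounded a Y P) : Integrable (fun ω => Y ω ^ 2) P := by
  refine ((h.integrable_exp hY le_rfl).const_mul a⁻¹).mono' (by fun_prop)
    (Filter.Eventually.of_forall fun ω => ?_)
  rw [Real.norm_eq_abs, abs_of_nonneg (sq_nonneg _), inv_mul_eq_div, le_div_iff₀ ha]
  have := Real.add_one_le_exp (a * Y ω ^ 2)
  linarith

theorem abs_exp_sub_one_sub_le (x : ℝ) :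
    |Real.exp x - 1 - x| ≤ x ^ 2 * Real.exp |x| := by
  have h := Complex.norm_exp_sub_sum_le_norm_mul_exp (x : ℂ) 2
  simp only [Finset.sum_range_succ, Finset.sum_range_zero, pow_zero, Nat.factorial, zero_add,
    pow_one] at h
  have e : Complex.exp x - (1 / ((1 : ℕ) : ℂ) + x / ((1 * 1 : ℕ) : ℂ))
      = ((Real.exp x - 1 - x : ℝ) : ℂ) := by
    push_cast; ring
  rw [e, Complex.norm_real, Complex.norm_real, Real.norm_eq_abs, Real.norm_eq_abs, sq_abs] at h
  exact h

/-- Half of the exponent `a y` pays for the quadratic factor of the Taylor remainder, the other half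
for its exponential. -/
theorem exp_mul_le_add_sq_mul_exp {a t y : ℝ} (ha : 0 < a) (hy : 0 ≤ y) (ht : |t| ≤ a / 2) :
    Real.exp (t * y) ≤ 1 + t * y + 8 * (t / a) ^ 2 * Real.exp (a * y) := by
  have h1 := (le_abs_self _).trans (abs_exp_sub_one_sub_le (t * y))
  have hX : 0 ≤ a * y := by positivity
  have h2 : |t * y| ≤ a * y / 2 := by
    rw [abs_mul, abs_of_nonneg hy]
    nlinarith
  have h3 := Real.exp_le_exp.2 h2
  have h4 := Real.quadratic_le_exp_of_nonneg (x := a * y / 2) (by positivity)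
  have h5 : (t * y) ^ 2 ≤ 8 * (t / a) ^ 2 * Real.exp (a * y / 2) := by
    have : (t * y) ^ 2 = 8 * (t / a) ^ 2 * ((a * y / 2) ^ 2 / 2) := by field_simp; norm_num
    rw [this]
    gcongr
    linarith
  have h6 : Real.exp (a * y) = Real.exp (a * y / 2) * Real.exp (a * y / 2) := by
    rw [← Real.exp_add]; congr 1; ring
  have h7 : (t * y) ^ 2 * Real.exp |t * y| ≤
      8 * (t / a) ^ 2 * Real.exp (a * y / 2) * Real.exp (a * y / 2) :=
    mul_le_mul h5 h3 (Real.exp_pos _).le (by positivity)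
  rw [h6]
  linarith

theorem ExpSqBounded.mgf_sq_le [IsProbabilityMeasure P] (hY : Measurable Y) (ha : 0 < a)
    (h : ExpSqBounded a Y P) {t : ℝ} (ht : |t| ≤ a / 2) :
    mgf (fun ω => Y ω ^ 2) P t ≤ Real.exp (t * ∫ ω, Y ω ^ 2 ∂P + 16 * (t / a) ^ 2) := by
  have hint := h.integrable_sq hY ha
  have hint2 := h.integrable_exp hY le_rfl
  have hta : t ≤ a := by linarith [le_abs_self t]
  calc mgf (fun ω => Y ω ^ 2) P t
      ≤ ∫ ω, (1 + t * Y ω ^ 2 + 8 * (t / a) ^ 2 * Real.exp (a * Y ω ^ 2)) ∂P :=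
        integral_mono (h.integrable_exp hY hta) (by fun_prop)
          fun ω => exp_mul_le_add_sq_mul_exp ha (sq_nonneg _) ht
    _ = 1 + t * ∫ ω, Y ω ^ 2 ∂P + 8 * (t / a) ^ 2 * ∫ ω, Real.exp (a * Y ω ^ 2) ∂P := by
        rw [integral_add (by fun_prop) (by fun_prop), integral_add (by fun_prop) (by fun_prop),
          integral_const_mul, integral_const_mul]
        simp
    _ ≤ 1 + t * ∫ ω, Y ω ^ 2 ∂P + 8 * (t / a) ^ 2 * 2 := by
        gcongr
        exact h.integral_exp_le hY
    _ ≤ _ := by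
        have := Real.add_one_le_exp (t * ∫ ω, Y ω ^ 2 ∂P + 16 * (t / a) ^ 2)
        linarith

theorem ExpSqBounded.measure_abs_ge_le [IsFiniteMeasure P] (hY : Measurable Y) (ha : 0 < a)
    (h : ExpSqBounded a Y P) {r : ℝ} (hr : 0 ≤ r) :
    P.real {ω | r ≤ |Y ω|} ≤ 2 * Real.exp (-(a * r ^ 2)) := by
  have h1 := measure_ge_le_exp_mul_mgf (X := fun ω => Y ω ^ 2) (μ := P) (r ^ 2) ha.le
    (h.integrable_exp hY le_rfl)
  have h2 : mgf (fun ω => Y ω ^ 2) P a ≤ 2 := h.integral_exp_le hY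
  have h3 : {ω | r ≤ |Y ω|} ⊆ {ω | r ^ 2 ≤ Y ω ^ 2} := fun ω hω => by
    simp only [Set.mem_ofPred_eq] at hω ⊢
    rw [← sq_abs (Y ω)]
    gcongr
  refine (measureReal_mono h3).trans (h1.trans ?_)
  rw [mul_comm, neg_mul]
  gcongr

/-- Bernstein's inequality by the Chernoff method, using the quadratic bound on the log-mgf of each
square. -/
theorem measure_abs_sum_sq_sub_ge_le [IsProbabilityMeasure P] {κ : Type*} [Fintype κ]
    {Y : κ → Ω → ℝ} (hind : iIndepFun Y P) (hY : ∀ k, Measurable (Y k)) (ha : 0 < a)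
    (h : ∀ k, ExpSqBounded a (Y k) P) {M : ℝ} (hM : ∀ k, ∫ ω, Y k ω ^ 2 ∂P = M) {δ : ℝ}
    (hδ : 0 ≤ δ) (haδ : a * δ ≤ 16) :
    P.real {ω | Fintype.card κ * δ ≤ |∑ k, Y k ω ^ 2 - Fintype.card κ * M|} ≤
      2 * Real.exp (-(Fintype.card κ * (a ^ 2 * δ ^ 2 / 64))) := by
  set m : ℝ := ((Fintype.card κ : ℕ) : ℝ)
  set S : Ω → ℝ := ∑ k, fun ω => Y k ω ^ 2 with hS
  have hSω : ∀ ω, S ω = ∑ k, Y k ω ^ 2 := fun ω => by simp [hS]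
  have hind' : iIndepFun (fun k ω => Y k ω ^ 2) P :=
    hind.comp (fun _ x => x ^ 2) fun _ => by fun_prop
  have hmgf : ∀ t, |t| ≤ a / 2 → mgf S P t ≤ Real.exp (m * (t * M + 16 * (t / a) ^ 2)) := by
    intro t ht
    rw [hS, hind'.mgf_sum (fun k => by fun_prop)]
    refine (Finset.prod_le_prod (fun k _ => mgf_nonneg)
      fun k _ => (h k).mgf_sq_le (hY k) ha ht).trans ?_
    simp only [hM, Finset.prod_const, Finset.card_univ]
    rw [← Real.exp_nat_mul]
  have hint : ∀ t, |t| ≤ a / 2 → Integrable (fun ω => Real.exp (t * S ω)) P := by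
    intro t ht
    rw [hS]
    exact hind'.integrable_exp_mul_sum (fun k => by fun_prop)
      fun k _ => (h k).integrable_exp (hY k) (by linarith [le_abs_self t])
  -- This minimizes `16 (t / a)² - t δ`, with value `-a² δ² / 64`; `haδ` keeps it within the range
  -- of `ExpSqBounded.mgf_sq_le`.
  set t := a ^ 2 * δ / 32 with ht
  have ht0 : 0 ≤ t := by positivity
  have hta : t ≤ a / 2 := by
    rw [ht]; nlinarith
  have key : ∀ s, s = t ∨ s = -t → m * (s * M + 16 * (s / a) ^ 2) - s * (m * M) - t * (m * δ) =
      -(m * (a ^ 2 * δ ^ 2 / 64)) := by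
    rintro s (rfl | rfl) <;> rw [ht] <;> field_simp <;> ring
  have hup : P.real {ω | m * M + m * δ ≤ S ω} ≤ Real.exp (-(m * (a ^ 2 * δ ^ 2 / 64))) := by
    have hta' : |t| ≤ a / 2 := by rwa [abs_of_nonneg ht0]
    refine (measure_ge_le_exp_mul_mgf _ ht0 (hint t hta')).trans ?_
    refine (mul_le_mul_of_nonneg_left (hmgf t hta') (Real.exp_pos _).le).trans ?_
    rw [← Real.exp_add, ← key t (Or.inl rfl)]
    refine Real.exp_le_exp.2 (le_of_eq ?_)
    ring
  have hlow : P.real {ω | S ω ≤ m * M - m * δ} ≤ Real.exp (-(m * (a ^ 2 * δ ^ 2 / 64))) := by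
    have hta' : |-t| ≤ a / 2 := by rwa [abs_neg, abs_of_nonneg ht0]
    refine (measure_le_le_exp_mul_mgf _ (neg_nonpos.2 ht0) (hint (-t) hta')).trans ?_
    refine (mul_le_mul_of_nonneg_left (hmgf (-t) hta') (Real.exp_pos _).le).trans ?_
    rw [← Real.exp_add, ← key (-t) (Or.inr rfl)]
    refine Real.exp_le_exp.2 (le_of_eq ?_)
    ring
  have hsub : {ω | m * δ ≤ |∑ k, Y k ω ^ 2 - m * M|} ⊆
      {ω | m * M + m * δ ≤ S ω} ∪ {ω | S ω ≤ m * M - m * δ} := by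
    intro ω hω
    simp only [Set.mem_ofPred_eq, Set.mem_union] at hω ⊢
    rw [← hSω] at hω
    rcases le_abs.1 hω with h1 | h1
    · left; linarith
    · right; linarith
  refine (measureReal_mono hsub).trans ((measureReal_union_le _ _).trans ?_)
  linarith

end

/-! ### From Orlicz norms to exponential moments -/

section

variable {Ω : Type*} [MeasurableSpace Ω] {P : Measure Ω}

theorem lintegral_enorm_pow_le_of_orliczNorm {Y : Ω → ℝ} {K : ℝ} (hK : 0 ≤ K)
    (h : orliczNorm 2 Y P ≤ ENNReal.ofReal K) {j : ℕ} (hj : 1 ≤ j) :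
    ∫⁻ ω, ENNReal.ofReal ((Y ω ^ 2) ^ j) ∂P ≤ ENNReal.ofReal ((2 * j * K ^ 2) ^ j) := by
  have hk : (1 : ℝ) ≤ 2 * j := by
    have : (1 : ℝ) ≤ j := by exact_mod_cast hj
    linarith
  have hkpos : (0 : ℝ) < 2 * j := by linarith
  have h1 : ENNReal.ofReal ((2 * j : ℝ) ^ (-(1 / 2 : ℝ))) * eLpNorm Y (ENNReal.ofReal (2 * j)) P ≤
      ENNReal.ofReal K :=
    (le_iSup₂ (f := fun (k : ℝ) (_ : 1 ≤ k) =>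
      ENNReal.ofReal (k ^ (-(1 / 2 : ℝ))) * eLpNorm Y (ENNReal.ofReal k) P) (2 * j : ℝ) hk).trans h
  have h2 : eLpNorm Y (ENNReal.ofReal (2 * j)) P ≤ ENNReal.ofReal ((2 * j : ℝ) ^ (1 / 2 : ℝ) * K) := by
    have e : ENNReal.ofReal ((2 * j : ℝ) ^ (1 / 2 : ℝ)) * ENNReal.ofReal ((2 * j : ℝ) ^ (-(1 / 2 : ℝ)))
        = 1 := by
      rw [← ENNReal.ofReal_mul (by positivity), ← Real.rpow_add hkpos]
      simp
    calc _ = ENNReal.ofReal ((2 * j : ℝ) ^ (1 / 2 : ℝ)) *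
          (ENNReal.ofReal ((2 * j : ℝ) ^ (-(1 / 2 : ℝ))) *
            eLpNorm Y (ENNReal.ofReal (2 * j)) P) := by rw [← mul_assoc, e, one_mul]
      _ ≤ _ := by
        rw [ENNReal.ofReal_mul (p := (2 * j : ℝ) ^ (1 / 2 : ℝ)) (by positivity)]
        exact mul_le_mul_right h1 _
  rw [eLpNorm_eq_lintegral_rpow_enorm_toReal (ENNReal.ofReal_pos.2 hkpos).ne' ENNReal.ofReal_ne_top,
    ENNReal.toReal_ofReal hkpos.le, one_div, ENNReal.rpow_inv_le_iff hkpos,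
    ENNReal.ofReal_rpow_of_nonneg (by positivity) hkpos.le] at h2
  refine (lintegral_mono fun ω => ?_).trans (h2.trans (ENNReal.ofReal_le_ofReal (le_of_eq ?_)))
  · rw [← ofReal_norm, ENNReal.ofReal_rpow_of_nonneg (norm_nonneg _) hkpos.le]
    refine ENNReal.ofReal_le_ofReal (le_of_eq ?_)
    rw [show (2 * j : ℝ) = ((2 * j : ℕ) : ℝ) by push_cast; ring, Real.rpow_natCast, pow_mul,
      Real.norm_eq_abs, sq_abs]
  · have e : ((2 * j : ℝ) ^ (1 / 2 : ℝ) * K) ^ (2 * j : ℝ) =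
        (((2 * j : ℝ) ^ (1 / 2 : ℝ) * K) ^ 2) ^ j := by
      rw [← pow_mul, ← Real.rpow_natCast]
      push_cast
      rfl
    rw [e, mul_pow, ← Real.sqrt_eq_rpow, Real.sq_sqrt hkpos.le]

/-- Expand the exponential. The moment of order `2j` and `j^j / j! ≤ e^j` bound the `j`-th term by
`(2 e a K²)^j = 2^(-j)`, and the geometric series sums to 2. -/
theorem expSqBounded_of_orliczNorm [IsProbabilityMeasure P] {Y : Ω → ℝ} (hY : Measurable Y) {K : ℝ}
    (hK : 0 < K) (h : orliczNorm 2 Y P ≤ ENNReal.ofReal K) :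
    ExpSqBounded (1 / (4 * Real.exp 1 * K ^ 2)) Y P := by
  set a := 1 / (4 * Real.exp 1 * K ^ 2) with ha
  have ha0 : 0 < a := by positivity
  have hpt : ∀ ω, ENNReal.ofReal (Real.exp (a * Y ω ^ 2)) =
      ∑' j : ℕ, ENNReal.ofReal ((a * Y ω ^ 2) ^ j / j.factorial) := by
    intro ω
    have hs := NormedSpace.expSeries_div_hasSum_exp (a * Y ω ^ 2)
    rw [← Real.exp_eq_exp_ℝ] at hs
    rw [← hs.tsum_eq, ENNReal.ofReal_tsum_of_nonneg (fun j => by positivity) hs.summable]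
  have hterm : ∀ j : ℕ, ∫⁻ ω, ENNReal.ofReal ((a * Y ω ^ 2) ^ j / j.factorial) ∂P ≤
      ENNReal.ofReal ((1 / 2) ^ j) := by
    intro j
    rcases Nat.eq_zero_or_pos j with rfl | hj
    · simp
    have e1 : ∀ ω, ENNReal.ofReal ((a * Y ω ^ 2) ^ j / j.factorial) =
        ENNReal.ofReal (a ^ j / j.factorial) * ENNReal.ofReal ((Y ω ^ 2) ^ j) := by
      intro ω
      rw [← ENNReal.ofReal_mul (by positivity)]
      congr 1
      rw [mul_pow]; ring
    simp only [e1]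
    rw [lintegral_const_mul' _ _ ENNReal.ofReal_ne_top]
    refine (mul_le_mul_right (lintegral_enorm_pow_le_of_orliczNorm hK.le h hj) _).trans ?_
    rw [← ENNReal.ofReal_mul (by positivity)]
    refine ENNReal.ofReal_le_ofReal ?_
    have e2 : (j : ℝ) ^ j / j.factorial ≤ Real.exp 1 ^ j := by
      have := Real.pow_div_factorial_le_exp (j : ℝ) (Nat.cast_nonneg j) j
      rwa [← Real.exp_nat_mul, mul_one]
    calc a ^ j / j.factorial * (2 * j * K ^ 2) ^ j
        = (2 * a * K ^ 2) ^ j * ((j : ℝ) ^ j / j.factorial) := by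
          rw [mul_pow, mul_pow, mul_pow, mul_pow]; ring
      _ ≤ (2 * a * K ^ 2) ^ j * Real.exp 1 ^ j := by gcongr
      _ = (1 / 2) ^ j := by
          rw [← mul_pow, ha]
          congr 1
          have := Real.exp_pos 1
          field_simp
          norm_num
  unfold ExpSqBounded
  simp only [hpt]
  rw [lintegral_tsum (fun j => by fun_prop)]
  refine (ENNReal.tsum_le_tsum hterm).trans ?_
  rw [← ENNReal.ofReal_tsum_of_nonneg (fun j => by positivity) summable_geometric_two,
    tsum_geometric_two]
  norm_num

end

/-! ### Linear forms of Gaussian inputs -/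

section Gaussian

variable {p : ℕ}

theorem stdNormal_map_dotProduct (b : Fin p → ℝ) :
    (stdNormal p).map (fun x => b ⬝ᵥ x) = (gaussianReal 0 1).map (fun x => eNorm b * x) := by
  have h1 : (fun x : Fin p → ℝ => b ⬝ᵥ x) =
      (innerSL ℝ (WithLp.toLp 2 b) : EuclideanSpace ℝ (Fin p) →L[ℝ] ℝ) ∘ WithLp.toLp 2 := by
    ext x
    simp [EuclideanSpace.inner_toLp_toLp, dotProduct_comm]
  rw [h1, ← Measure.map_map (by fun_prop) (by fun_prop), stdNormal, map_pi_eq_stdGaussian,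
    IsGaussian.map_eq_gaussianReal, gaussianReal_map_const_mul, integral_strongDual_stdGaussian,
    variance_dual_stdGaussian]
  congr 1
  · simp
  · rw [innerSL_apply_norm, norm_toLp_eq_eNorm]
    ext
    simp [eNorm_nonneg]

theorem lintegral_exp_sq_gaussianReal :
    ∫⁻ x, ENNReal.ofReal (Real.exp (1 / 4 * x ^ 2)) ∂(gaussianReal 0 1) ≤ 2 := by
  have hmeas : Measurable (gaussianPDF 0 1) := measurable_gaussianPDF _ _
  rw [gaussianReal_of_var_ne_zero _ one_ne_zero,
    lintegral_withDensity_eq_lintegral_mul _ hmeas (by fun_prop)]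
  have e : ∀ x, (gaussianPDF 0 1 * fun x => ENNReal.ofReal (Real.exp (1 / 4 * x ^ 2))) x =
      ENNReal.ofReal ((√(2 * Real.pi))⁻¹ * Real.exp (-(1 / 4) * x ^ 2)) := by
    intro x
    simp only [Pi.mul_apply, gaussianPDF, gaussianPDFReal]
    rw [← ENNReal.ofReal_mul (by positivity), mul_assoc, ← Real.exp_add]
    congr 2
    · simp
    · congr 1
      simp
      ring
  simp only [e]
  rw [← ofReal_integral_eq_lintegral_ofReal
    ((integrable_exp_neg_mul_sq (by norm_num)).const_mul _)
    (Filter.Eventually.of_forall fun x => by positivity), integral_const_mul, integral_gaussian]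
  have h2 : (√(2 * Real.pi))⁻¹ * √(Real.pi / (1 / 4)) ≤ 2 := by
    have hpi := Real.pi_pos
    rw [← Real.sqrt_inv, ← Real.sqrt_mul (by positivity)]
    have : (2 * Real.pi)⁻¹ * (Real.pi / (1 / 4)) = 2 := by field_simp; norm_num
    rw [this]
    exact Real.sqrt_le_iff.2 ⟨by norm_num, by norm_num⟩
  calc _ ≤ ENNReal.ofReal 2 := ENNReal.ofReal_le_ofReal h2
    _ = 2 := by norm_num

variable {Ω : Type*} [MeasurableSpace Ω] {P : Measure Ω} {u : Ω → Fin p → ℝ}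

theorem map_dotProduct_of_stdNormal (hu : Measurable u) (h : P.map u = stdNormal p)
    (b : Fin p → ℝ) :
    P.map (fun ω => b ⬝ᵥ u ω) = (gaussianReal 0 1).map (fun x => eNorm b * x) := by
  rw [← stdNormal_map_dotProduct, ← h, Measure.map_map (by fun_prop) hu]
  rfl

theorem expSqBounded_stdNormal (hu : Measurable u) (h : P.map u = stdNormal p) {b : Fin p → ℝ}
    (hb : eNorm b ≤ 1) : ExpSqBounded (1 / 4) (fun ω => b ⬝ᵥ u ω) P := by
  have e := map_dotProduct_of_stdNormal hu h b
  unfold ExpSqBounded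
  rw [← lintegral_map (f := fun y => ENNReal.ofReal (Real.exp (1 / 4 * y ^ 2)))
    (g := fun ω => b ⬝ᵥ u ω) (by fun_prop) (by fun_prop), e, lintegral_map (by fun_prop)
    (by fun_prop)]
  refine (lintegral_mono fun x => ENNReal.ofReal_le_ofReal (Real.exp_le_exp.2 ?_)).trans
    lintegral_exp_sq_gaussianReal
  rw [mul_pow]
  have : eNorm b ^ 2 ≤ 1 := pow_le_one₀ (eNorm_nonneg b) hb
  nlinarith [mul_le_mul_of_nonneg_right this (sq_nonneg x)]

theorem integral_dotProduct_stdNormal (hu : Measurable u) (h : P.map u = stdNormal p)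
    (b : Fin p → ℝ) : ∫ ω, b ⬝ᵥ u ω ∂P = 0 := by
  have e := map_dotProduct_of_stdNormal hu h b
  rw [← integral_map (f := fun y => y) (φ := fun ω => b ⬝ᵥ u ω) (by fun_prop) (by fun_prop), e,
    integral_map (by fun_prop) (by fun_prop), integral_const_mul, integral_id_gaussianReal, mul_zero]

theorem integral_dotProduct_sq_stdNormal (hu : Measurable u) (h : P.map u = stdNormal p)
    (b : Fin p → ℝ) : ∫ ω, (b ⬝ᵥ u ω) ^ 2 ∂P = eNorm b ^ 2 := by
  have e := map_dotProduct_of_stdNormal hu h b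
  have hv : ∫ x, x ^ 2 ∂(gaussianReal 0 1) = 1 := by
    have := variance_fun_id_gaussianReal (μ := 0) (v := 1)
    rw [variance_of_integral_eq_zero (by fun_prop) integral_id_gaussianReal] at this
    simpa using this
  rw [← integral_map (f := fun y => y ^ 2) (φ := fun ω => b ⬝ᵥ u ω) (by fun_prop) (by fun_prop), e,
    integral_map (by fun_prop) (by fun_prop)]
  simp only [mul_pow]
  rw [integral_const_mul, hv, mul_one]

end Gaussian

/-! ### Uniform bounds by nets -/

section

variable {Ω : Type*} [MeasurableSpace Ω] {P : Measure Ω} {ι : Type*} [Fintype ι] {a : ℝ}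

theorem measureReal_exists_mem_finset_le [IsFiniteMeasure P] {α : Type*} (T : Finset α)
    (s : α → Set Ω) {b c : ℝ} (hb : 0 ≤ b) (hT : (T.card : ℝ) ≤ c) (h : ∀ v ∈ T, P.real (s v) ≤ b) :
    P.real {ω | ∃ v ∈ T, ω ∈ s v} ≤ c * b := by
  have e : {ω | ∃ v ∈ T, ω ∈ s v} = ⋃ v ∈ T, s v := by ext; simp
  rw [e]
  refine (measureReal_biUnion_finset_le T s).trans ((Finset.sum_le_sum h).trans ?_)
  rw [Finset.sum_const, nsmul_eq_mul]
  gcongr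

theorem measure_eNorm_gt_le [IsFiniteMeasure P] {X : Ω → ι → ℝ} (hX : Measurable X) (ha : 0 < a)
    (h : ∀ v, eNorm v ≤ 2 → ExpSqBounded a (fun ω => v ⬝ᵥ X ω) P) {r : ℝ} (hr : 0 ≤ r) :
    P.real {ω | 2 * r < eNorm (X ω)} ≤ 25 ^ Fintype.card ι * (2 * Real.exp (-(a * r ^ 2))) := by
  obtain ⟨T, hcard, hT2, hT⟩ := exists_quarter_net ι
  have hsub : {ω | 2 * r < eNorm (X ω)} ⊆ {ω | ∃ v ∈ T, ω ∈ {ω | r ≤ |v ⬝ᵥ X ω|}} := by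
    intro ω hω
    by_contra hcon
    simp only [Set.mem_ofPred_eq, not_exists, not_and, not_le] at hcon
    exact absurd (eNorm_le_of_net hT fun v hv => (hcon v hv).le) (not_le.2 hω)
  refine (measureReal_mono hsub).trans ?_
  refine measureReal_exists_mem_finset_le T _ (by positivity) (by exact_mod_cast hcard)
    fun v hv => ?_
  exact (h v (hT2 v hv)).measure_abs_ge_le (by fun_prop) ha hr

/-- The deviation is a symmetric quadratic form in `w`, so the Bernstein bound at the net points
controls it everywhere, with the factor 3 of `abs_quadForm_le_of_net`. -/
theorem measure_exists_quadForm_gt_le [IsProbabilityMeasure P] {κ : Type*} [Fintype κ]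
    {X : κ → Ω → ι → ℝ} (hind : iIndepFun X P) (hX : ∀ k, Measurable (X k)) (ha : 0 < a)
    (h : ∀ k v, eNorm v ≤ 2 → ExpSqBounded a (fun ω => v ⬝ᵥ X k ω) P) {S : Matrix ι ι ℝ}
    (hS : S.IsSymm) (hM : ∀ k v, ∫ ω, (v ⬝ᵥ X k ω) ^ 2 ∂P = v ⬝ᵥ S *ᵥ v) {δ : ℝ} (hδ : 0 ≤ δ)
    (haδ : a * δ ≤ 16) :
    P.real {ω | ∃ w, 3 * (Fintype.card κ * δ) * eNorm w ^ 2 <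
        |∑ k, (w ⬝ᵥ X k ω) ^ 2 - Fintype.card κ * (w ⬝ᵥ S *ᵥ w)|} ≤
      25 ^ Fintype.card ι * (2 * Real.exp (-(Fintype.card κ * (a ^ 2 * δ ^ 2 / 64)))) := by
  obtain ⟨T, hcard, hT2, hT⟩ := exists_quarter_net ι
  set m : ℝ := ((Fintype.card κ : ℕ) : ℝ)
  let M : Ω → Matrix ι ι ℝ := fun ω => ∑ k, Matrix.vecMulVec (X k ω) (X k ω) - m • S
  have hMsymm : ∀ ω, (M ω).IsSymm := by
    intro ω
    simp only [M, Matrix.IsSymm, Matrix.transpose_sub, Matrix.transpose_sum, Matrix.transpose_smul,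
      Matrix.transpose_vecMulVec, hS.eq]
  have hMw : ∀ ω w, w ⬝ᵥ M ω *ᵥ w = ∑ k, (w ⬝ᵥ X k ω) ^ 2 - m * (w ⬝ᵥ S *ᵥ w) := by
    intro ω w
    simp only [M, Matrix.sub_mulVec, Matrix.smul_mulVec, dotProduct_sub, dotProduct_smul,
      smul_eq_mul, Matrix.sum_mulVec, dotProduct_sum]
    congr 1
    refine Finset.sum_congr rfl fun k _ => ?_
    rw [Matrix.vecMulVec_mulVec, op_smul_eq_smul, dotProduct_smul, smul_eq_mul, sq,
      dotProduct_comm (X k ω) w]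
  have hsub : {ω | ∃ w, 3 * (m * δ) * eNorm w ^ 2 <
        |∑ k, (w ⬝ᵥ X k ω) ^ 2 - m * (w ⬝ᵥ S *ᵥ w)|} ⊆
      {ω | ∃ v ∈ T, ω ∈ {ω | m * δ ≤ |∑ k, (v ⬝ᵥ X k ω) ^ 2 - m * (v ⬝ᵥ S *ᵥ v)|}} := by
    rintro ω ⟨w, hw⟩
    by_contra hcon
    simp only [Set.mem_ofPred_eq, not_exists, not_and, not_le] at hcon
    refine absurd (abs_quadForm_le_of_net hT (hMsymm ω) (δ := m * δ) (fun v hv => ?_) w) ?_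
    · rw [hMw]; exact (hcon v hv).le
    · rw [hMw]; exact not_le.2 hw
  refine (measureReal_mono hsub).trans ?_
  refine measureReal_exists_mem_finset_le T _ (by positivity) (by exact_mod_cast hcard)
    fun v hv => ?_
  exact measure_abs_sum_sq_sub_ge_le
    (hind.comp (fun _ x => v ⬝ᵥ x) fun _ => by fun_prop) (fun k => by fun_prop) ha
    (fun k => h k v (hT2 v hv)) (fun k => hM k v) hδ haδ

theorem integral_dotProduct_sq {X : Ω → ι → ℝ}
    (hX : Measurable X) (h : ∀ v, Integrable (fun ω => (v ⬝ᵥ X ω) ^ 2) P) (v : ι → ℝ) :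
    ∫ ω, (v ⬝ᵥ X ω) ^ 2 ∂P = v ⬝ᵥ (Matrix.of fun i j => ∫ ω, X ω i * X ω j ∂P) *ᵥ v := by
  classical
  have hL : ∀ i, MemLp (fun ω => X ω i) 2 P := by
    intro i
    rw [memLp_two_iff_integrable_sq (by fun_prop)]
    simpa using h (Pi.single i 1)
  have hint : ∀ i j, Integrable (fun ω => X ω i * X ω j) P := fun i j =>
    (hL i).integrable_mul (hL j)
  have e : ∀ ω, (v ⬝ᵥ X ω) ^ 2 = ∑ i, ∑ j, v i * (v j * (X ω i * X ω j)) := by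
    intro ω
    rw [dotProduct, sq, Finset.sum_mul_sum]
    refine Finset.sum_congr rfl fun i _ => Finset.sum_congr rfl fun j _ => by ring
  simp only [e]
  rw [integral_finsetSum _ fun i _ => integrable_finsetSum _ fun j _ =>
    ((hint i j).const_mul _).const_mul _]
  simp only [dotProduct, Matrix.mulVec, Matrix.of_apply, Finset.mul_sum]
  refine Finset.sum_congr rfl fun i _ => ?_
  rw [integral_finsetSum _ fun j _ => ((hint i j).const_mul _).const_mul _]
  refine Finset.sum_congr rfl fun j _ => ?_
  rw [integral_const_mul, integral_const_mul]
  ring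

end

/-! ### Independence of disjoint input windows -/

section Blocks

variable {Ω E : Type*} [MeasurableSpace Ω] [MeasurableSpace E] {P : Measure Ω}

/-- Independence says that the joint law is a product measure, and currying sends a product over
pairs to a product of products. -/
theorem iIndepFun_curry [IsProbabilityMeasure P] {ι κ : Type*} {f : ι × κ → Ω → E} (hf : ∀ i, Measurable (f i))
    (h : iIndepFun f P) : iIndepFun (fun i ω j => f (i, j) ω) P := by
  have hpm : ∀ i, IsProbabilityMeasure (P.map (f i)) := fun i =>
    Measure.isProbabilityMeasure_map (hf i).aemeasurable
  have hrow : ∀ i, P.map (fun ω j => f (i, j) ω) = Measure.infinitePi fun j => P.map (f (i, j)) :=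
    fun i => (h.precomp (Prod.mk_right_injective i)).map_fun_eq_infinitePi_map fun j => hf (i, j)
  rw [iIndepFun_iff_map_fun_eq_infinitePi_map (by fun_prop)]
  simp only [hrow]
  rw [← Measure.infinitePi_map_curry (fun i j => P.map (f (i, j)))]
  have e : (fun ω i j => f (i, j) ω) = MeasurableEquiv.curry ι κ E ∘ fun ω q => f q ω := rfl
  rw [e, ← Measure.map_map (by fun_prop) (by fun_prop), h.map_fun_eq_infinitePi_map hf]

theorem map_window_eq {u : ℕ → Ω → E} (hu : ∀ t, Measurable (u t)) (hind : iIndepFun u P)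
    {ν : Measure E} (hlaw : ∀ t, P.map (u t) = ν) (a l : ℕ) :
    P.map (fun ω (j : Fin l) => u (a + j) ω) = Measure.infinitePi fun _ => ν := by
  have hinj : Function.Injective fun j : Fin l => a + (j : ℕ) := fun i j hij =>
    Fin.ext (Nat.add_left_cancel hij)
  rw [(hind.precomp hinj).map_fun_eq_infinitePi_map fun j => hu _]
  simp only [hlaw]

theorem iIndepFun_windows [IsProbabilityMeasure P] {u : ℕ → Ω → E} (hu : ∀ t, Measurable (u t)) (hind : iIndepFun u P)
    (b m l : ℕ) : iIndepFun (fun (k : Fin m) ω (j : Fin l) => u (b + k * l + j) ω) P := by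
  have hinj : Function.Injective fun q : Fin m × Fin l => b + q.1 * l + (q.2 : ℕ) := by
    rintro ⟨i, j⟩ ⟨i', j'⟩ h
    have h' : (i : ℕ) * l + j = i' * l + j' := by simp only at h; omega
    have hl : 0 < l := j.pos
    have e1 : (j : ℕ) = j' := by
      have := congrArg (· % l) h'
      simpa [Nat.mul_add_mod', Nat.mod_eq_of_lt j.2, Nat.mod_eq_of_lt j'.2] using this
    have e2 : (i : ℕ) = i' := by
      rw [e1] at h'
      exact Nat.eq_of_mul_eq_mul_right hl (Nat.add_right_cancel h')
    exact Prod.ext (Fin.ext e2) (Fin.ext e1)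
  exact iIndepFun_curry (fun q => hu _) (hind.precomp hinj)

end Blocks

/-! ### Restarted states and their samples -/

section State

variable {n p : ℕ} {φ : ℝ → ℝ} (A : Matrix (Fin n) (Fin n) ℝ) (B : Matrix (Fin n) (Fin p) ℝ)

theorem state_congr {u v : ℕ → Fin p → ℝ} : ∀ t, (∀ s < t, u s = v s) →
    state φ A B u t = state φ A B v t
  | 0, _ => rfl
  | t + 1, h => by
    simp only [state]
    rw [state_congr t fun s hs => h s (by omega), h t (by omega)]

theorem measurable_state (hφ : Measurable φ) :
    ∀ t, Measurable fun u : ℕ → Fin p → ℝ => state φ A B u t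
  | 0 => by simp only [state]; exact measurable_const
  | t + 1 => by
    have := measurable_state hφ t
    simp only [state]
    refine measurable_pi_lambda _ fun i => hφ.comp ?_
    simp only [Pi.add_apply, Matrix.mulVec, dotProduct]
    fun_prop

/-- The true and restarted trajectories share their inputs, so each step contracts their difference
by `‖A‖`; initially it is the state at time `a`. -/
theorem eNorm_state_add_sub_le (hφ : LipschitzWith 1 φ) (u : ℕ → Fin p → ℝ) (a : ℕ) : ∀ j,
    eNorm (state φ A B u (a + j) - state φ A B (fun s => u (a + s)) j) ≤
      ‖A‖ ^ j * eNorm (state φ A B u a)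
  | 0 => by simp [state]
  | j + 1 => by
    have ih := eNorm_state_add_sub_le hφ u a j
    have h1 : eNorm (state φ A B u (a + (j + 1)) - state φ A B (fun s => u (a + s)) (j + 1)) ≤
        eNorm (A *ᵥ (state φ A B u (a + j) - state φ A B (fun s => u (a + s)) j)) := by
      refine eNorm_mono fun i => ?_
      rw [← add_assoc]
      simp only [state, Pi.sub_apply, Matrix.mulVec_sub, Pi.add_apply]
      have := hφ.dist_le_mul
        ((A *ᵥ state φ A B u (a + j)) i + (B *ᵥ u (a + j)) i)
        ((A *ᵥ state φ A B (fun s => u (a + s)) j) i + (B *ᵥ u (a + j)) i)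
      simpa [Real.dist_eq] using this
    refine h1.trans ((eNorm_mulVec_le _ _).trans ?_)
    rw [pow_succ', mul_assoc]
    exact mul_le_mul_of_nonneg_left ih (norm_nonneg _)

/-- The centered and rescaled state at time `l`, the input at time `l`, and a constant entry. -/
def centeredSample (φ : ℝ → ℝ) (A : Matrix (Fin n) (Fin n) ℝ) (B : Matrix (Fin n) (Fin p) ℝ) (s : ℝ)
    (c : Fin n → ℝ) (l : ℕ) (u : ℕ → Fin p → ℝ) : (Fin n ⊕ Fin p) ⊕ Unit → ℝ :=
  Sum.elim (Sum.elim (s • (state φ A B u l - c)) (u l)) fun _ => 1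

theorem measurable_sumElim {α ι κ : Type*} [MeasurableSpace α] {f : α → ι → ℝ} {g : α → κ → ℝ}
    (hf : Measurable f) (hg : Measurable g) : Measurable fun x => Sum.elim (f x) (g x) := by
  refine measurable_pi_lambda _ fun i => ?_
  rcases i with i | i
  · exact measurable_pi_apply i |>.comp hf
  · exact measurable_pi_apply i |>.comp hg

variable {A B} in
theorem measurable_centeredSample (hφ : Measurable φ) (s : ℝ) (c : Fin n → ℝ) (l : ℕ) :
    Measurable (centeredSample φ A B s c l) := by
  have := measurable_state A B hφ l
  exact measurable_sumElim (measurable_sumElim (by fun_prop) (by fun_prop)) (by fun_prop)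

variable {A B} in
theorem centeredSample_congr {s : ℝ} {c : Fin n → ℝ} {l : ℕ} {u v : ℕ → Fin p → ℝ}
    (h : ∀ j < l + 1, u j = v j) :
    centeredSample φ A B s c l u = centeredSample φ A B s c l v := by
  unfold centeredSample
  rw [state_congr A B l fun j hj => h j (by omega), h l (by omega)]

/-- Extension of a finite window by zero. -/
def extendZero {l : ℕ} (w : Fin l → Fin p → ℝ) : ℕ → Fin p → ℝ :=
  fun j => if h : j < l then w ⟨j, h⟩ else 0

theorem measurable_extendZero {l : ℕ} : Measurable (extendZero : (Fin l → Fin p → ℝ) → _) := by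
  refine measurable_pi_lambda _ fun j => ?_
  unfold extendZero
  split_ifs <;> fun_prop

variable {A B} in
theorem centeredSample_eq_comp {Ω : Type*} {u : ℕ → Ω → Fin p → ℝ} (s : ℝ) (c : Fin n → ℝ) (l b : ℕ) :
    (fun ω => centeredSample φ A B s c l fun j => u (b + j) ω) =
      (centeredSample φ A B s c l ∘ extendZero) ∘ fun ω (j : Fin (l + 1)) => u (b + j) ω := by
  funext ω
  refine centeredSample_congr fun j hj => ?_
  simp [extendZero, hj]

variable {A B} {Ω : Type*} [MeasurableSpace Ω] {P : Measure Ω}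
  {u : ℕ → Ω → Fin p → ℝ}

/-- A sample reads `l + 1` inputs: `l` for the restarted state and one for the input entry. Starts
spaced by `l + 1` thus use disjoint windows. -/
theorem iIndepFun_centeredSample [IsProbabilityMeasure P] (hφ : Measurable φ) (hu : ∀ t, Measurable (u t))
    (hind : iIndepFun u P) (s : ℝ) (c : Fin n → ℝ) (l b m : ℕ) :
    iIndepFun (fun (k : Fin m) ω =>
      centeredSample φ A B s c l fun j => u (b + k * (l + 1) + j) ω) P := by
  have e : (fun (k : Fin m) ω =>
      centeredSample φ A B s c l fun j => u (b + k * (l + 1) + j) ω) = fun (k : Fin m) =>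
      (centeredSample φ A B s c l ∘ extendZero) ∘
        fun ω (j : Fin (l + 1)) => u (b + k * (l + 1) + j) ω :=
    funext fun k => centeredSample_eq_comp s c l (b + k * (l + 1))
  rw [e]
  exact (iIndepFun_windows hu hind b m (l + 1)).comp _ fun k =>
    (measurable_centeredSample hφ s c l).comp measurable_extendZero

theorem identDistrib_centeredSample (hφ : Measurable φ) (hu : ∀ t, Measurable (u t))
    (hind : iIndepFun u P) (hlaw : ∀ t, P.map (u t) = stdNormal p)
    (s : ℝ) (c : Fin n → ℝ) (l b : ℕ) :
    IdentDistrib (fun ω => centeredSample φ A B s c l fun j => u (b + j) ω)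
      (fun ω => centeredSample φ A B s c l fun j => u j ω) P P := by
  have h : IdentDistrib (fun ω (j : Fin (l + 1)) => u (b + j) ω)
      (fun ω (j : Fin (l + 1)) => u (0 + j) ω) P P := by
    refine ⟨by fun_prop, by fun_prop, ?_⟩
    rw [map_window_eq hu hind hlaw, map_window_eq hu hind hlaw]
  have h2 := h.comp ((measurable_centeredSample (A := A) (B := B) hφ s c l).comp
    measurable_extendZero)
  rw [← centeredSample_eq_comp, ← centeredSample_eq_comp] at h2
  simpa only [zero_add] using h2

theorem indepFun_state_input (hφ : Measurable φ) (hu : ∀ t, Measurable (u t))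
    (hind : iIndepFun u P) (l : ℕ) :
    IndepFun (fun ω => state φ A B (fun j => u j ω) l) (u l) P := by
  have h := hind.indepFun_finset (Finset.range l) {l} (by simp) hu
  have hm : Measurable fun w : Finset.range l → Fin p → ℝ =>
      state φ A B (fun j => if hj : j ∈ Finset.range l then w ⟨j, hj⟩ else 0) l := by
    refine (measurable_state A B hφ l).comp (measurable_pi_lambda _ fun j => ?_)
    split_ifs <;> fun_prop
  have h2 := h.comp hm (measurable_pi_apply (⟨l, by simp⟩ : ({l} : Finset ℕ)))
  have e : (fun ω => state φ A B (fun j => u j ω) l) = fun ω => state φ A B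
      (fun j => if hj : j ∈ Finset.range l then u j ω else 0) l := by
    funext ω
    refine state_congr A B l fun j hj => ?_
    simp [hj]
  rw [e]
  exact h2

end State

/-- The exponential rate of the squared linear forms of a sample, given the subgaussian
constant `K` of the state. -/
noncomputable def sampleRate (K : ℝ) : ℝ := 1 / (144 * (Real.exp 1 * K ^ 2 + 1))

theorem sampleRate_pos (K : ℝ) : 0 < sampleRate K := by
  have := Real.exp_pos 1
  unfold sampleRate; positivity

theorem sampleRate_le (K : ℝ) : sampleRate K ≤ 1 / 144 := by
  have := Real.exp_pos 1
  unfold sampleRate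
  gcongr
  have : 0 ≤ Real.exp 1 * K ^ 2 := by positivity
  linarith

/-! ### Moments of a restarted sample -/

section

variable {Ω : Type*} [MeasurableSpace Ω] {P : Measure Ω}

theorem ExpSqBounded.dotProduct_of_unit {ι : Type*} [Fintype ι] {X : Ω → ι → ℝ} {a : ℝ}
    (h : ∀ v, eNorm v ≤ 1 → ExpSqBounded a (fun ω => v ⬝ᵥ X ω) P) {v : ι → ℝ} (hv : eNorm v ≤ 2) :
    ExpSqBounded (a / 4) (fun ω => v ⬝ᵥ X ω) P := by
  refine (h ((1 / 2 : ℝ) • v) ?_).mono fun ω => le_of_eq ?_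
  · rw [eNorm_smul, abs_of_pos (by norm_num)]; linarith
  · rw [smul_dotProduct, smul_eq_mul]; ring

theorem ExpSqBounded.weaken {a a' : ℝ} {Y : Ω → ℝ} (h : ExpSqBounded a Y P) (ha : a' ≤ a) :
    ExpSqBounded a' Y P :=
  h.mono fun _ => mul_le_mul_of_nonneg_right ha (sq_nonneg _)

theorem expSqBounded_centered [IsProbabilityMeasure P] {n : ℕ} {X : Ω → Fin n → ℝ}
    (hX : Measurable X) {K γ : ℝ} (hK : 0 < K) (hγ : 0 < γ)
    (h : subgaussianNorm (fun ω => X ω - meanVec X P) P ≤ ENNReal.ofReal (K * √γ)) {v : Fin n → ℝ}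
    (hv : eNorm v ≤ 1) :
    ExpSqBounded (36 * sampleRate K)
      (fun ω => v ⬝ᵥ ((1 / √γ) • (X ω - meanVec X P))) P := by
  have h1 : orliczNorm 2 (fun ω => v ⬝ᵥ (X ω - meanVec X P)) P ≤ ENNReal.ofReal (K * √γ) :=
    (le_iSup₂ (f := fun (v : Fin n → ℝ) (_ : eNorm v ≤ 1) =>
      orliczNorm 2 (fun ω => v ⬝ᵥ (X ω - meanVec X P)) P) v hv).trans h
  have hs : 0 < √γ := Real.sqrt_pos.2 hγ
  refine (expSqBounded_of_orliczNorm (by fun_prop) (by positivity) h1).mono fun ω => ?_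
  rw [dotProduct_smul, smul_eq_mul, mul_pow, mul_pow, div_pow, one_pow, Real.sq_sqrt hγ.le,
    sampleRate]
  have he := Real.exp_pos 1
  have e1 : 36 * (1 / (144 * (Real.exp 1 * K ^ 2 + 1))) ≤ 1 / (4 * Real.exp 1 * K ^ 2) := by
    rw [show 36 * (1 / (144 * (Real.exp 1 * K ^ 2 + 1))) = 1 / (4 * (Real.exp 1 * K ^ 2 + 1)) by
      field_simp; norm_num]
    exact one_div_le_one_div_of_le (by positivity) (by linarith)
  calc _ ≤ 1 / (4 * Real.exp 1 * K ^ 2) * (1 / γ * (v ⬝ᵥ (X ω - meanVec X P)) ^ 2) := by gcongr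
    _ = _ := by field_simp

theorem integral_centered_eq_zero [IsProbabilityMeasure P] {Y : Ω → ℝ} (hY : Integrable Y P) :
    ∫ ω, (Y ω - ∫ ω', Y ω' ∂P) ∂P = 0 := by
  rw [integral_sub hY (integrable_const _)]
  simp

theorem integral_add_add_const_sq [IsProbabilityMeasure P] {X Y : Ω → ℝ} (hX : MemLp X 2 P)
    (hY : MemLp Y 2 P) (hX1 : ∫ ω, X ω ∂P = 0) (hY1 : ∫ ω, Y ω ∂P = 0)
    (hXY : ∫ ω, X ω * Y ω ∂P = 0) (d : ℝ) :
    ∫ ω, (X ω + Y ω + d) ^ 2 ∂P = ∫ ω, X ω ^ 2 ∂P + ∫ ω, Y ω ^ 2 ∂P + d ^ 2 := by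
  have hXY' : Integrable (fun ω => 2 * (X ω * Y ω)) P := (hX.integrable_mul hY).const_mul 2
  have hX' : Integrable (fun ω => 2 * d * X ω) P := (hX.integrable (by norm_num)).const_mul _
  have hY' : Integrable (fun ω => 2 * d * Y ω) P := (hY.integrable (by norm_num)).const_mul _
  have h1 : Integrable (fun ω => X ω ^ 2 + Y ω ^ 2) P := hX.integrable_sq.add hY.integrable_sq
  have h2 : Integrable (fun ω => X ω ^ 2 + Y ω ^ 2 + d ^ 2) P := h1.add (integrable_const _)
  have h3 : Integrable (fun ω => X ω ^ 2 + Y ω ^ 2 + d ^ 2 + 2 * (X ω * Y ω)) P := h2.add hXY'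
  have h4 : Integrable (fun ω => X ω ^ 2 + Y ω ^ 2 + d ^ 2 + 2 * (X ω * Y ω) + 2 * d * X ω) P :=
    h3.add hX'
  have e : ∀ ω, (X ω + Y ω + d) ^ 2 = X ω ^ 2 + Y ω ^ 2 + d ^ 2 + 2 * (X ω * Y ω)
      + 2 * d * X ω + 2 * d * Y ω := fun ω => by ring
  simp only [e]
  rw [integral_add h4 hY', integral_add h3 hX', integral_add h2 hXY',
    integral_add h1 (integrable_const _), integral_add hX.integrable_sq hY.integrable_sq,
    integral_const_mul, integral_const_mul, integral_const_mul, hXY, hX1, hY1]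
  simp

end

section

variable {n p : ℕ} {φ : ℝ → ℝ} {A : Matrix (Fin n) (Fin n) ℝ} {B : Matrix (Fin n) (Fin p) ℝ}
  {Ω : Type*} [MeasurableSpace Ω] {P : Measure Ω} [IsProbabilityMeasure P] {u : ℕ → Ω → Fin p → ℝ}
  {K γ : ℝ} {l : ℕ}

theorem dotProduct_centeredSample (s : ℝ) (c : Fin n → ℝ) (w : ℕ → Fin p → ℝ)
    (α : Fin n → ℝ) (b : Fin p → ℝ) (d : Unit → ℝ) :
    Sum.elim (Sum.elim α b) d ⬝ᵥ centeredSample φ A B s c l w =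
      α ⬝ᵥ (s • (state φ A B w l - c)) + b ⬝ᵥ w l + d () := by
  simp [centeredSample]

theorem measurable_state_apply (hφ : Measurable φ) (hu : ∀ t, Measurable (u t)) (t : ℕ) :
    Measurable fun ω => state φ A B (fun j => u j ω) t :=
  (measurable_state A B hφ t).comp (measurable_pi_lambda _ hu)

theorem expSqBounded_centeredSample (hφ : Measurable φ) (hu : ∀ t, Measurable (u t))
    (hlaw : ∀ t, P.map (u t) = stdNormal p) (hK : 0 < K) (hγ : 0 < γ)
    (h : subgaussianNorm (fun ω => state φ A B (fun j => u j ω) l -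
      meanVec (fun ω => state φ A B (fun j => u j ω) l) P) P ≤ ENNReal.ofReal (K * √γ))
    {v : (Fin n ⊕ Fin p) ⊕ Unit → ℝ} (hv : eNorm v ≤ 2) :
    ExpSqBounded (sampleRate K) (fun ω => v ⬝ᵥ centeredSample φ A B (1 / √γ)
      (meanVec (fun ω => state φ A B (fun j => u j ω) l) P) l fun j => u j ω) P := by
  have hst := measurable_state_apply (A := A) (B := B) hφ hu l
  -- The factor 9 pays for the three summands (state, input, constant), the factor 4 for passing
  -- from the unit ball to radius 2, where the net lies.
  rw [show sampleRate K = 36 * sampleRate K / 9 / 4 by ring]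
  refine ExpSqBounded.dotProduct_of_unit (fun v hv => ?_) hv
  obtain ⟨α, b, d, rfl⟩ : ∃ α b d, v = Sum.elim (Sum.elim α b) d :=
    ⟨fun i => v (Sum.inl (Sum.inl i)), fun i => v (Sum.inl (Sum.inr i)), fun i => v (Sum.inr i), by
      ext ((i | i) | i) <;> rfl⟩
  have hsq : eNorm α ^ 2 + eNorm b ^ 2 + d () ^ 2 ≤ 1 := by
    have e := eNorm_sumElim_sq (Sum.elim α b) d
    rw [eNorm_sumElim_sq α b, eNorm_sq d] at e
    simp only [Finset.univ_unique, PUnit.default_eq_unit, Finset.sum_singleton] at e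
    rw [← e]
    exact pow_le_one₀ (eNorm_nonneg _) hv
  have hα : eNorm α ≤ 1 := by
    rw [← sq_le_one_iff₀ (eNorm_nonneg _)]; nlinarith [sq_nonneg (eNorm b), sq_nonneg (d ())]
  have hb : eNorm b ≤ 1 := by
    rw [← sq_le_one_iff₀ (eNorm_nonneg _)]; nlinarith [sq_nonneg (eNorm α), sq_nonneg (d ())]
  have hr := sampleRate_le K
  have hr0 := sampleRate_pos K
  simp only [dotProduct_centeredSample]
  refine ExpSqBounded.add_add (by fun_prop) (by fun_prop) (by positivity)
    (expSqBounded_centered hst hK hγ h hα)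
    ((expSqBounded_stdNormal (hu l) (hlaw l) hb).weaken (by linarith)) (expSqBounded_const ?_)
  have : d () ^ 2 ≤ 1 := by nlinarith [sq_nonneg (eNorm b), sq_nonneg (eNorm α)]
  nlinarith [mul_le_mul_of_nonneg_left this hr0.le]

/-- The centered state and the input are independent with mean zero, so all cross terms vanish. The
input has second moment 1, which dominates `γ' / γ`. -/
theorem integral_centeredSample_sq_ge (hφ : Measurable φ) (hu : ∀ t, Measurable (u t))
    (hind : iIndepFun u P) (hlaw : ∀ t, P.map (u t) = stdNormal p) (hK : 0 < K) (hγ : 0 < γ)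
    (h : subgaussianNorm (fun ω => state φ A B (fun j => u j ω) l -
      meanVec (fun ω => state φ A B (fun j => u j ω) l) P) P ≤ ENNReal.ofReal (K * √γ))
    {γ' : ℝ} (hγ' : γ' ≤ γ)
    (hcov : (covMatrix (fun ω => state φ A B (fun j => u j ω) l) P -
      γ' • (1 : Matrix (Fin n) (Fin n) ℝ)).PosSemidef)
    (α : Fin n → ℝ) (b : Fin p → ℝ) (d : Unit → ℝ) :
    γ' / γ * (eNorm α ^ 2 + eNorm b ^ 2) + d () ^ 2 ≤
      ∫ ω, (Sum.elim (Sum.elim α b) d ⬝ᵥ centeredSample φ A B (1 / √γ)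
        (meanVec (fun ω => state φ A B (fun j => u j ω) l) P) l fun j => u j ω) ^ 2 ∂P := by
  have hst := measurable_state_apply (A := A) (B := B) hφ hu l
  set H : Ω → Fin n → ℝ := fun ω => state φ A B (fun j => u j ω) l with hH
  have hr0 := sampleRate_pos K
  have hs : 0 < √γ := Real.sqrt_pos.2 hγ
  have hintu : ∀ v, eNorm v ≤ 1 → Integrable
      (fun ω => (v ⬝ᵥ ((1 / √γ) • (H ω - meanVec H P))) ^ 2) P := fun v hv =>
    (expSqBounded_centered hst hK hγ h hv).integrable_sq (by fun_prop) (by positivity)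
  have hint : ∀ v : Fin n → ℝ, Integrable (fun ω => (v ⬝ᵥ (H ω - meanVec H P)) ^ 2) P := by
    intro v
    by_cases hv : eNorm v = 0
    · simp [eNorm_eq_zero hv]
    have hvp : 0 < eNorm v := lt_of_le_of_ne (eNorm_nonneg v) (Ne.symm hv)
    have h1 := (hintu ((eNorm v)⁻¹ • v) (by
      rw [eNorm_smul, abs_of_pos (inv_pos.2 hvp), inv_mul_cancel₀ hv])).const_mul
        (eNorm v ^ 2 * γ)
    refine h1.congr (Filter.Eventually.of_forall fun ω => ?_)
    simp only [smul_dotProduct, dotProduct_smul, smul_eq_mul]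
    have : √γ ^ 2 = γ := Real.sq_sqrt hγ.le
    field_simp
    rw [this]
  have hlin : ∀ v : Fin n → ℝ, Integrable (fun ω => v ⬝ᵥ (H ω - meanVec H P)) P := fun v =>
    ((memLp_two_iff_integrable_sq (by fun_prop)).2 (hint v)).integrable (by norm_num)
  have hHi : ∀ i, Integrable (fun ω => H ω i) P := by
    intro i
    have := (hlin (Pi.single i 1)).add (integrable_const (meanVec H P i))
    refine this.congr (Filter.Eventually.of_forall fun ω => ?_)
    simp
  have hmean : ∀ v : Fin n → ℝ, ∫ ω, v ⬝ᵥ (H ω - meanVec H P) ∂P = 0 := by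
    intro v
    simp only [dotProduct, Pi.sub_apply, meanVec]
    have hci : ∀ i, Integrable (fun ω => H ω i - ∫ ω', H ω' i ∂P) P := fun i =>
      (hHi i).sub (integrable_const _)
    rw [integral_finsetSum _ fun i _ => (hci i).const_mul _]
    refine Finset.sum_eq_zero fun i _ => ?_
    rw [integral_const_mul, integral_centered_eq_zero (hHi i), mul_zero]
  have hsec : γ' * eNorm α ^ 2 ≤ ∫ ω, (α ⬝ᵥ (H ω - meanVec H P)) ^ 2 ∂P := by
    rw [integral_dotProduct_sq (by fun_prop) hint]
    have e := hcov.dotProduct_mulVec_nonneg α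
    rw [star_trivial, Matrix.sub_mulVec, dotProduct_sub, Matrix.smul_mulVec, Matrix.one_mulVec,
      dotProduct_smul, smul_eq_mul, ← eNorm_sq_eq_dotProduct, sub_nonneg] at e
    exact e
  set X : Ω → ℝ := fun ω => α ⬝ᵥ ((1 / √γ) • (H ω - meanVec H P)) with hX
  set Y : Ω → ℝ := fun ω => b ⬝ᵥ u l ω with hY
  have hXe : ∀ ω, X ω = 1 / √γ * (α ⬝ᵥ (H ω - meanVec H P)) := fun ω => by
    rw [hX]; simp only [dotProduct_smul, smul_eq_mul]
  have hXm : Measurable X := by fun_prop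
  have hYm : Measurable Y := by fun_prop
  have hX1 : ∫ ω, X ω ∂P = 0 := by
    simp only [hXe]; rw [integral_const_mul, hmean, mul_zero]
  have hX2 : γ' / γ * eNorm α ^ 2 ≤ ∫ ω, X ω ^ 2 ∂P := by
    simp only [hXe, mul_pow]
    rw [integral_const_mul, div_pow, one_pow, Real.sq_sqrt hγ.le]
    calc _ = 1 / γ * (γ' * eNorm α ^ 2) := by ring
      _ ≤ _ := by gcongr
  have hXi : Integrable (fun ω => X ω ^ 2) P := by
    simp only [hXe, mul_pow]
    exact (hint α).const_mul _
  have hY1 : ∫ ω, Y ω ∂P = 0 := integral_dotProduct_stdNormal (hu l) (hlaw l) b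
  have hY2 : ∫ ω, Y ω ^ 2 ∂P = eNorm b ^ 2 := integral_dotProduct_sq_stdNormal (hu l) (hlaw l) b
  have hYi : Integrable (fun ω => Y ω ^ 2) P := by
    by_cases hb : eNorm b = 0
    · simp [hY, eNorm_eq_zero hb]
    · exact Integrable.of_integral_ne_zero (by rw [hY2]; positivity)
  have hXL : MemLp X 2 P := (memLp_two_iff_integrable_sq (by fun_prop)).2 hXi
  have hYL : MemLp Y 2 P := (memLp_two_iff_integrable_sq (by fun_prop)).2 hYi
  have hXY : ∫ ω, X ω * Y ω ∂P = 0 := by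
    have hi : IndepFun X Y P := (indepFun_state_input (A := A) (B := B) hφ hu hind l).comp
      (φ := fun x => α ⬝ᵥ ((1 / √γ) • (x - meanVec H P))) (ψ := fun x => b ⬝ᵥ x)
      (by fun_prop) (by fun_prop)
    rw [hi.integral_fun_mul_eq_mul_integral (by fun_prop) (by fun_prop), hX1, zero_mul]
  simp only [dotProduct_centeredSample]
  change _ ≤ ∫ ω, (X ω + Y ω + d ()) ^ 2 ∂P
  rw [integral_add_add_const_sq hXL hYL hX1 hY1 hXY, hY2]
  have hle : γ' / γ ≤ 1 := (div_le_one hγ).2 hγ'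
  have := mul_le_mul_of_nonneg_right hle (sq_nonneg (eNorm b))
  linarith

end

theorem pow_mul_le_one_of_mixingLength {c ρ a : ℝ} {n l : ℕ} (hpos : 0 < c * n * ρ) (ha : 0 ≤ a)
    (ha1 : a < 1) (hL : l + 1 = mixingLength c ρ n a) (hl : 1 ≤ l) : a ^ l * (c * n * ρ) ≤ 1 := by
  have h1 : (1 : ℝ) < 1 - Real.log (c * n * ρ) / Real.log a := by
    have : 1 < mixingLength c ρ n a := by omega
    simpa using Nat.lt_ceil.1 this
  have h2 : 1 - Real.log (c * n * ρ) / Real.log a ≤ l + 1 := by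
    have := Nat.le_ceil (1 - Real.log (c * n * ρ) / Real.log a)
    rw [mixingLength] at hL
    rw [← hL] at this
    exact_mod_cast this
  -- If `a = 0`, the convention `log 0 = 0` makes the length 1, contrary to `1 ≤ l`.
  have ha0 : 0 < a := by
    refine lt_of_le_of_ne ha fun h => ?_
    rw [← h] at h1
    simp at h1
  have hlog : Real.log a < 0 := Real.log_neg ha0 ha1
  have h3 : -Real.log (c * n * ρ) / Real.log a ≤ l := by rw [neg_div]; linarith
  rw [div_le_iff_of_neg hlog] at h3
  rw [← Real.log_nonpos_iff (by positivity), Real.log_mul (by positivity) hpos.ne', Real.log_pow]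
  linarith

theorem sum_range_mul_add {M : Type*} [AddCommMonoid M] (g : ℕ → M) (m L : ℕ) :
    ∑ a ∈ Finset.range (m * L), g a = ∑ j : Fin L, ∑ k : Fin m, g (j + k * L) := by
  rw [Finset.sum_comm, Fin.sum_univ_eq_sum_range (fun k => ∑ j : Fin L, g (j + k * L)) m]
  induction m with
  | zero => simp
  | succ m ih =>
    rw [add_mul, one_mul, Finset.sum_range_add, ih, Finset.sum_range_succ,
      Fin.sum_univ_eq_sum_range (fun j => g (j + m * L)) L]
    simp only [add_comm]

/-! ### Lower bound for the empirical second moment -/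

section

variable {n p N : ℕ} {φ : ℝ → ℝ} {A : Matrix (Fin n) (Fin n) ℝ} {B : Matrix (Fin n) (Fin p) ℝ}

/-- The feature's linear form is `y + z`, with `y` the form of the restarted sample and `z` the
restart error. The coefficient `s * (α ⬝ᵥ c)` of the constant entry restores the mean removed by
centering. -/
theorem sq_feature_ge (u : ℕ → Fin p → ℝ) (c : Fin n → ℝ) {s ε : ℝ} (l a : ℕ) (hs : 0 ≤ s)
    (hε : s * eNorm (state φ A B u (a + l) - state φ A B (fun j => u (a + j)) l) ≤ ε)
    (α : Fin n → ℝ) (b : Fin p → ℝ) :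
    7 / 8 * (Sum.elim (Sum.elim α b) (fun _ => s * (α ⬝ᵥ c)) ⬝ᵥ
      centeredSample φ A B s c l fun j => u (a + j)) ^ 2 - 8 * (ε ^ 2 * eNorm α ^ 2) ≤
      (Sum.elim α b ⬝ᵥ Sum.elim (s • state φ A B u (a + l)) (u (a + l))) ^ 2 := by
  set y := Sum.elim (Sum.elim α b) (fun _ => s * (α ⬝ᵥ c)) ⬝ᵥ
      centeredSample φ A B s c l fun j => u (a + j) with hy
  set z := s * (α ⬝ᵥ (state φ A B u (a + l) - state φ A B (fun j => u (a + j)) l)) with hz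
  have e : Sum.elim α b ⬝ᵥ Sum.elim (s • state φ A B u (a + l)) (u (a + l)) = y + z := by
    rw [hy, hz, dotProduct_centeredSample, sumElim_dotProduct_sumElim]
    simp only [dotProduct_smul, dotProduct_sub, smul_eq_mul]
    ring
  have hzb : |z| ≤ ε * eNorm α := by
    rw [hz, abs_mul, abs_of_nonneg hs]
    calc _ ≤ s * (eNorm α * eNorm (state φ A B u (a + l) -
          state φ A B (fun j => u (a + j)) l)) := by gcongr; exact abs_dotProduct_le _ _
      _ = s * eNorm (state φ A B u (a + l) - state φ A B (fun j => u (a + j)) l) * eNorm α := by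
        ring
      _ ≤ _ := by gcongr; exact eNorm_nonneg α
  have hz2 : z ^ 2 ≤ ε ^ 2 * eNorm α ^ 2 := by
    rw [← sq_abs z, ← mul_pow]
    gcongr
  rw [e]
  nlinarith [sq_nonneg (y / 8 + z)]

theorem sum_sq_feature_ge (u : ℕ → Fin p → ℝ) (c : Fin n → ℝ) {s ε ρ : ℝ} {l m : ℕ} (hs : 0 ≤ s)
    (hρ : 1 ≤ ρ) (hl : 1 ≤ l)
    (hε : ∀ a < m * (l + 1),
      s * eNorm (state φ A B u (a + l) - state φ A B (fun j => u (a + j)) l) ≤ ε)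
    (hε2 : ε ^ 2 ≤ 1 / (144 * ρ))
    {S : Matrix ((Fin n ⊕ Fin p) ⊕ Unit) ((Fin n ⊕ Fin p) ⊕ Unit) ℝ}
    (hS : ∀ (α : Fin n → ℝ) (b : Fin p → ℝ) (d : Unit → ℝ),
      ρ⁻¹ * (eNorm α ^ 2 + eNorm b ^ 2) + d () ^ 2 ≤
        Sum.elim (Sum.elim α b) d ⬝ᵥ S *ᵥ Sum.elim (Sum.elim α b) d)
    (hdev : ∀ j < l + 1, ∀ w, |∑ k : Fin m, (w ⬝ᵥ centeredSample φ A B s c l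
      fun i => u (j + k * (l + 1) + i)) ^ 2 - m * (w ⬝ᵥ S *ᵥ w)| ≤
        3 * (m * (1 / (24 * ρ))) * eNorm w ^ 2)
    (hmN : m * (l + 1) + l ≤ N) (hN : 32 * N ≤ 45 * (m * (l + 1))) (v : Fin n ⊕ Fin p → ℝ) :
    N * (1 / (2 * ρ)) * ∑ j, v j ^ 2 ≤
      ∑ k : Fin N, (v ⬝ᵥ feature s (state φ A B u) u k) ^ 2 := by
  have hρ0 : 0 < ρ := by linarith
  obtain ⟨α, b, rfl⟩ : ∃ α b, v = Sum.elim α b :=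
    ⟨fun i => v (Sum.inl i), fun i => v (Sum.inr i), by ext (i | i) <;> rfl⟩
  set w : (Fin n ⊕ Fin p) ⊕ Unit → ℝ := Sum.elim (Sum.elim α b) (fun _ => s * (α ⬝ᵥ c)) with hw
  set d := s * (α ⬝ᵥ c) with hd
  set V := eNorm α ^ 2 + eNorm b ^ 2 with hV
  have hV0 : 0 ≤ V := by positivity
  have hwn : eNorm w ^ 2 = V + d ^ 2 := by
    rw [hw, eNorm_sumElim_sq (Sum.elim α b), eNorm_sumElim_sq, eNorm_sq fun _ : Unit => d]
    simp [hV]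
  let f : ℕ → ℝ := fun t =>
    (Sum.elim α b ⬝ᵥ Sum.elim (s • state φ A B u (t + 1)) (u (t + 1))) ^ 2
  have hf0 : ∀ t, 0 ≤ f t := fun t => sq_nonneg _
  have hsum : ∑ k : Fin N, (Sum.elim α b ⬝ᵥ feature s (state φ A B u) u k) ^ 2 =
      ∑ t ∈ Finset.range N, f t := Fin.sum_univ_eq_sum_range f N
  -- A window starting at `a` ends at time `a + l`, which has index `a + (l - 1)` because features
  -- start at time 1. The remaining terms are nonnegative and dropped.
  have hshift : ∑ a ∈ Finset.range (m * (l + 1)), f (a + (l - 1)) ≤ ∑ t ∈ Finset.range N, f t := by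
    rw [← Finset.sum_image (s := Finset.range (m * (l + 1))) (g := fun a => a + (l - 1)) (f := f)
      fun x _ y _ h => Nat.add_right_cancel h]
    refine Finset.sum_le_sum_of_subset_of_nonneg (fun t ht => ?_) fun t _ _ => hf0 t
    obtain ⟨a, ha, rfl⟩ := Finset.mem_image.1 ht
    rw [Finset.mem_range] at ha ⊢
    omega
  rw [hsum]
  refine le_trans ?_ hshift
  rw [sum_range_mul_add]
  have hinv : 1 / (144 * ρ) = ρ⁻¹ / 144 := by field_simp
  have hinv2 : 3 * (m * (1 / (24 * ρ))) = m * ρ⁻¹ / 8 := by field_simp; ring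
  have hρi : ρ⁻¹ ≤ 1 := inv_le_one_of_one_le₀ hρ
  have hρi0 : 0 < ρ⁻¹ := by positivity
  -- One residue class. The deviation costs `1/8` and the restart error `8/144`, leaving `7/8 * 7/8
  -- - 1/18 ≥ 45/64`; the `d²` part of the deviation is absorbed by the full `d²` in `hS`.
  have hrow : ∀ j : Fin (l + 1), m * ρ⁻¹ * V * (45 / 64) ≤
      ∑ k : Fin m, f (j + k * (l + 1) + (l - 1)) := by
    intro j
    have hpt : ∀ k : Fin m, 7 / 8 * (w ⬝ᵥ centeredSample φ A B s c l
        fun i => u (j + k * (l + 1) + i)) ^ 2 - 8 * (ρ⁻¹ / 144 * V) ≤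
        f (j + k * (l + 1) + (l - 1)) := by
      intro k
      have hlt : (j : ℕ) + k * (l + 1) < m * (l + 1) := by
        have h1 := j.2
        have h2 := Nat.mul_le_mul_right (l + 1) (Nat.succ_le_of_lt k.2)
        rw [Nat.succ_mul] at h2
        omega
      have h1 := sq_feature_ge u c l _ hs (hε _ hlt) α b
      have h2 : (j : ℕ) + k * (l + 1) + (l - 1) + 1 = j + k * (l + 1) + l := by omega
      simp only [f]
      rw [h2]
      refine le_trans ?_ h1
      have h3 : ε ^ 2 * eNorm α ^ 2 ≤ ρ⁻¹ / 144 * V := by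
        rw [← hinv]
        have : eNorm α ^ 2 ≤ V := by rw [hV]; linarith [sq_nonneg (eNorm b)]
        exact mul_le_mul hε2 this (sq_nonneg _) (by positivity)
      linarith
    refine le_trans ?_ (Finset.sum_le_sum fun k _ => hpt k)
    rw [Finset.sum_sub_distrib, ← Finset.mul_sum, Finset.sum_const, Finset.card_univ,
      Fintype.card_fin, nsmul_eq_mul]
    have h4 := (abs_le.1 (hdev j j.2 w)).1
    rw [hinv2, hwn] at h4
    have h5 := mul_le_mul_of_nonneg_left (hS α b fun _ => d) (Nat.cast_nonneg' m : (0 : ℝ) ≤ m)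
    have h6 : (m : ℝ) * ρ⁻¹ * d ^ 2 ≤ m * d ^ 2 := by
      have := mul_le_mul_of_nonneg_left hρi (by positivity : 0 ≤ (m : ℝ) * d ^ 2)
      linarith
    have h7 : 0 ≤ (m : ℝ) * ρ⁻¹ * V := by positivity
    have h8 : 0 ≤ (m : ℝ) * d ^ 2 := by positivity
    rw [← hV, ← hw] at h5
    nlinarith [h4, h5, h6, h7, h8]
  refine le_trans ?_ (Finset.sum_le_sum fun j _ => hrow j)
  rw [Finset.sum_const, Finset.card_univ, Fintype.card_fin, nsmul_eq_mul, ← eNorm_sq,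
    eNorm_sumElim_sq, ← hV]
  have hN' : (32 : ℝ) * N ≤ 45 * (m * (l + 1)) := by exact_mod_cast hN
  have h9 := mul_le_mul_of_nonneg_right hN' (by positivity : 0 ≤ ρ⁻¹ * V)
  have e : (N : ℝ) * (1 / (2 * ρ)) * V = N * (ρ⁻¹ * V) / 2 := by field_simp
  rw [e]
  push_cast
  linarith

end

/-! ### The good event -/

section

variable {n p : ℕ} {φ : ℝ → ℝ} {A : Matrix (Fin n) (Fin n) ℝ} {B : Matrix (Fin n) (Fin p) ℝ}
  {Ω : Type*} [MeasurableSpace Ω] {P : Measure Ω} [IsProbabilityMeasure P] {u : ℕ → Ω → Fin p → ℝ}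
  {K γ γ' : ℝ} {l : ℕ}

/-- Restarted samples have the same law at every starting time, so one matrix `S` serves all residue
classes. -/
theorem exists_secondMoment_and_measure_dev_le (hφ : Measurable φ) (hu : ∀ t, Measurable (u t))
    (hind : iIndepFun u P) (hlaw : ∀ t, P.map (u t) = stdNormal p) (hK : 0 < K) (hγ : 0 < γ)
    (h : subgaussianNorm (fun ω => state φ A B (fun j => u j ω) l -
      meanVec (fun ω => state φ A B (fun j => u j ω) l) P) P ≤ ENNReal.ofReal (K * √γ))
    (hγ' : γ' ≤ γ)
    (hcov : (covMatrix (fun ω => state φ A B (fun j => u j ω) l) P -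
      γ' • (1 : Matrix (Fin n) (Fin n) ℝ)).PosSemidef) :
    ∃ S : Matrix ((Fin n ⊕ Fin p) ⊕ Unit) ((Fin n ⊕ Fin p) ⊕ Unit) ℝ,
      (∀ (α : Fin n → ℝ) (b : Fin p → ℝ) (d : Unit → ℝ),
        γ' / γ * (eNorm α ^ 2 + eNorm b ^ 2) + d () ^ 2 ≤
          Sum.elim (Sum.elim α b) d ⬝ᵥ S *ᵥ Sum.elim (Sum.elim α b) d) ∧
      ∀ (m b : ℕ) (δ : ℝ), 0 ≤ δ → δ ≤ 1 →
        P.real {ω | ∃ w, 3 * (m * δ) * eNorm w ^ 2 <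
          |∑ k : Fin m, (w ⬝ᵥ centeredSample φ A B (1 / √γ)
            (meanVec (fun ω => state φ A B (fun j => u j ω) l) P) l
            fun i => u (b + k * (l + 1) + i) ω) ^ 2 - m * (w ⬝ᵥ S *ᵥ w)|} ≤
        25 ^ (n + p + 1) * (2 * Real.exp (-(m * (sampleRate K ^ 2 * δ ^ 2 / 64)))) := by
  set c := meanVec (fun ω => state φ A B (fun j => u j ω) l) P with hc
  set s := 1 / √γ with hs
  have hr0 := sampleRate_pos K
  have hr1 := sampleRate_le K
  have hm : ∀ b, Measurable fun ω => centeredSample φ A B s c l fun j => u (b + j) ω := fun b =>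
    (measurable_centeredSample hφ s c l).comp (measurable_pi_lambda _ fun j => hu (b + j))
  have hm0 : Measurable fun ω => centeredSample φ A B s c l fun j => u j ω := by
    simpa using hm 0
  have hid := identDistrib_centeredSample (A := A) (B := B) hφ hu hind hlaw s c l
  have hexp : ∀ v, eNorm v ≤ 2 → ExpSqBounded (sampleRate K)
      (fun ω => v ⬝ᵥ centeredSample φ A B s c l fun j => u j ω) P := fun v hv =>
    expSqBounded_centeredSample hφ hu hlaw hK hγ h hv
  have hexp' : ∀ b v, eNorm v ≤ 2 → ExpSqBounded (sampleRate K)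
      (fun ω => v ⬝ᵥ centeredSample φ A B s c l fun j => u (b + j) ω) P := by
    intro b v hv
    refine le_trans (le_of_eq ?_) (hexp v hv)
    exact ((hid b).comp (u := fun x => ENNReal.ofReal (Real.exp (sampleRate K * (v ⬝ᵥ x) ^ 2)))
      (by fun_prop)).lintegral_eq
  have hint : ∀ v, Integrable
      (fun ω => (v ⬝ᵥ centeredSample φ A B s c l fun j => u j ω) ^ 2) P := by
    intro v
    by_cases hv : eNorm v = 0
    · simp [eNorm_eq_zero hv]
    have hvp : 0 < eNorm v := lt_of_le_of_ne (eNorm_nonneg v) (Ne.symm hv)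
    have h1 := ((hexp ((eNorm v)⁻¹ • v) (by
      rw [eNorm_smul, abs_of_pos (inv_pos.2 hvp), inv_mul_cancel₀ hv]
      norm_num)).integrable_sq (by fun_prop) hr0).const_mul (eNorm v ^ 2)
    refine h1.congr (Filter.Eventually.of_forall fun ω => ?_)
    simp only [smul_dotProduct, smul_eq_mul]
    field_simp
  obtain ⟨S, hSsymm, hsec⟩ : ∃ S : Matrix ((Fin n ⊕ Fin p) ⊕ Unit) ((Fin n ⊕ Fin p) ⊕ Unit) ℝ,
      S.IsSymm ∧ ∀ v, ∫ ω, (v ⬝ᵥ centeredSample φ A B s c l fun j => u j ω) ^ 2 ∂P =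
        v ⬝ᵥ S *ᵥ v := by
    refine ⟨_, ?_, integral_dotProduct_sq hm0 hint⟩
    ext i j
    simp only [Matrix.transpose_apply, Matrix.of_apply, mul_comm]
  refine ⟨S, fun α b d => ?_, fun m b δ hδ hδ1 => ?_⟩
  · rw [← hsec]
    exact integral_centeredSample_sq_ge hφ hu hind hlaw hK hγ h hγ' hcov α b d
  · have hdev := measure_exists_quadForm_gt_le
      (iIndepFun_centeredSample (A := A) (B := B) hφ hu hind s c l b m) (fun k => hm _) hr0
      (fun k => hexp' _) hSsymm ?_ hδ (by nlinarith)
    · simpa only [Fintype.card_fin, Fintype.card_sum, Fintype.card_unit] using hdev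
    · intro k v
      rw [← hsec v]
      exact ((hid _).comp (u := fun x => (v ⬝ᵥ x) ^ 2) (by fun_prop)).integral_eq

end

theorem pow_twentyFive_le_exp (d : ℕ) : (25 : ℝ) ^ d ≤ Real.exp (4 * d) := by
  have h : (25 : ℝ) ≤ Real.exp 4 := by
    have h1 : (2.7 : ℝ) ≤ Real.exp 1 := by have := Real.exp_one_gt_d9; linarith
    calc (25 : ℝ) ≤ 2.7 ^ 4 := by norm_num
      _ ≤ Real.exp 1 ^ 4 := by gcongr
      _ = Real.exp 4 := by rw [← Real.exp_nat_mul]; norm_num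
  calc (25 : ℝ) ^ d ≤ Real.exp 4 ^ d := by gcongr
    _ = Real.exp (4 * d) := by rw [← Real.exp_nat_mul, mul_comm]

/-- The constant `104 = 100 + 4` leaves the rate 100 after paying `e^(4q)` for the net. -/
theorem measure_eNorm_gt_le_exp {Ω ι : Type*} [MeasurableSpace Ω] [Fintype ι] {P : Measure Ω}
    [IsFiniteMeasure P] {X : Ω → ι → ℝ} (hX : Measurable X) {a : ℝ} (ha : 0 < a)
    (h : ∀ v, eNorm v ≤ 2 → ExpSqBounded a (fun ω => v ⬝ᵥ X ω) P) {q : ℕ}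
    (hq : Fintype.card ι ≤ q) :
    P.real {ω | 2 * √(104 / a) * √q < eNorm (X ω)} ≤ 2 * Real.exp (-100 * q) := by
  have h1 := measure_eNorm_gt_le hX ha h (r := √(104 / a) * √q) (by positivity)
  rw [← mul_assoc] at h1
  refine h1.trans ?_
  have e : a * (√(104 / a) * √q) ^ 2 = 104 * q := by
    rw [mul_pow, Real.sq_sqrt (by positivity), Real.sq_sqrt (by positivity)]
    field_simp
  rw [e]
  calc _ ≤ Real.exp (4 * Fintype.card ι) * (2 * Real.exp (-(104 * q))) := by
        gcongr; exact pow_twentyFive_le_exp _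
    _ ≤ Real.exp (4 * q) * (2 * Real.exp (-(104 * q))) := by gcongr
    _ = 2 * (Real.exp (4 * q) * Real.exp (-(104 * q))) := by ring
    _ = _ := by rw [← Real.exp_add]; congr 2; ring

/-- The bad event involves an uncountable union over `w`; a measurable hull avoids proving it
measurable. -/
theorem exists_measurableSet_compl_subset {Ω : Type*} [MeasurableSpace Ω] {P : Measure Ω}
    [IsProbabilityMeasure P] {bad : Set Ω} {x : ℝ} (h : P.real bad ≤ x) :
    ∃ E, MeasurableSet E ∧ 1 - x ≤ P.real E ∧ ∀ ω ∈ E, ω ∉ bad := by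
  refine ⟨(toMeasurable P bad)ᶜ, (measurableSet_toMeasurable _ _).compl, ?_, fun ω hω hb =>
    hω (subset_toMeasurable _ _ hb)⟩
  rw [probReal_compl_eq_one_sub (measurableSet_toMeasurable _ _), measureReal_def,
    measure_toMeasurable, ← measureReal_def]
  linarith

section

variable {n p : ℕ} {φ : ℝ → ℝ} {A : Matrix (Fin n) (Fin n) ℝ} {B : Matrix (Fin n) (Fin p) ℝ}
  {Ω : Type*} [MeasurableSpace Ω] {P : Measure Ω} [IsProbabilityMeasure P] {u : ℕ → Ω → Fin p → ℝ}
  {K γplus γminus θ : ℝ} {l : ℕ}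

theorem exists_good_event (hφ : Measurable φ) (hu : ∀ t, Measurable (u t))
    (hind : iIndepFun u P) (hlaw : ∀ t, P.map (u t) = stdNormal p) (hK : 0 < K)
    (hγ : γminus ≤ γplus)
    (hwb : WellBehaved K (l + 1) γplus γminus θ (fun t ω => state φ A B (fun s => u s ω) t) P)
    (N m : ℕ) {δ x : ℝ} (hδ : 0 ≤ δ) (hδ1 : δ ≤ 1)
    (hx : 25 ^ (n + p + 1) * (2 * Real.exp (-(m * (sampleRate K ^ 2 * δ ^ 2 / 64)))) ≤ x) :
    ∃ (S : Matrix ((Fin n ⊕ Fin p) ⊕ Unit) ((Fin n ⊕ Fin p) ⊕ Unit) ℝ) (E : Set Ω),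
      (∀ (α : Fin n → ℝ) (b : Fin p → ℝ) (d : Unit → ℝ),
        γminus / γplus * (eNorm α ^ 2 + eNorm b ^ 2) + d () ^ 2 ≤
          Sum.elim (Sum.elim α b) d ⬝ᵥ S *ᵥ Sum.elim (Sum.elim α b) d) ∧
      MeasurableSet E ∧
      1 - 4 * N * Real.exp (-100 * n) - (l + 1) * x ≤ P.real E ∧
      ∀ ω ∈ E,
        (∀ t < N, eNorm ((1 / √γplus) • (state φ A B (fun s => u s ω) (t + 1) -
          meanVec (fun ω => state φ A B (fun s => u s ω) (t + 1)) P)) ≤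
            2 * √(104 / sampleRate K) * √n) ∧
        (∀ t < N, eNorm (u (t + 1) ω) ≤ 2 * √(104 / sampleRate K) * √(n + p)) ∧
        ∀ j < l + 1, ∀ w, |∑ k : Fin m, (w ⬝ᵥ centeredSample φ A B (1 / √γplus)
            (meanVec (fun ω => state φ A B (fun s => u s ω) l) P) l
            fun i => u (j + k * (l + 1) + i) ω) ^ 2 - m * (w ⬝ᵥ S *ᵥ w)| ≤
              3 * (m * δ) * eNorm w ^ 2 := by
  have hr0 := sampleRate_pos K
  have hr1 := sampleRate_le K
  have hγp := hwb.γplus_pos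
  obtain ⟨S, hS, hdev⟩ := exists_secondMoment_and_measure_dev_le hφ hu hind hlaw hK hγp
    (hwb.subgaussian l) hγ hwb.cov_lower
  set r := 2 * √(104 / sampleRate K)
  let s₁ : ℕ → Set Ω := fun t => {ω | r * √n < eNorm ((1 / √γplus) •
    (state φ A B (fun s => u s ω) (t + 1) -
      meanVec (fun ω => state φ A B (fun s => u s ω) (t + 1)) P))}
  let s₂ : ℕ → Set Ω := fun t => {ω | r * √(n + p) < eNorm (u (t + 1) ω)}
  let s₃ : ℕ → Set Ω := fun j => {ω | ∃ w, 3 * (m * δ) * eNorm w ^ 2 <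
    |∑ k : Fin m, (w ⬝ᵥ centeredSample φ A B (1 / √γplus)
      (meanVec (fun ω => state φ A B (fun s => u s ω) l) P) l
      fun i => u (j + k * (l + 1) + i) ω) ^ 2 - m * (w ⬝ᵥ S *ᵥ w)|}
  have hb₁ : P.real {ω | ∃ t ∈ Finset.range N, ω ∈ s₁ t} ≤ N * (2 * Real.exp (-100 * n)) := by
    refine measureReal_exists_mem_finset_le _ s₁ (by positivity) (by simp) fun t _ => ?_
    have hst := measurable_state_apply (A := A) (B := B) hφ hu (t + 1)
    refine measure_eNorm_gt_le_exp (by fun_prop) hr0 (fun v hv => ?_) (by simp)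
    refine (ExpSqBounded.dotProduct_of_unit (fun v hv =>
      expSqBounded_centered hst hK hγp (hwb.subgaussian (t + 1)) hv) hv).weaken (by linarith)
  have hb₂ : P.real {ω | ∃ t ∈ Finset.range N, ω ∈ s₂ t} ≤ N * (2 * Real.exp (-100 * n)) := by
    refine measureReal_exists_mem_finset_le _ s₂ (by positivity) (by simp) fun t _ => ?_
    have h := measure_eNorm_gt_le_exp (P := P) (hu (t + 1)) hr0 (fun v hv =>
      (ExpSqBounded.dotProduct_of_unit (fun v hv =>
        expSqBounded_stdNormal (hu (t + 1)) (hlaw (t + 1)) hv) hv).weaken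
          (by linarith : sampleRate K ≤ 1 / 4 / 4)) (q := n + p) (by simp)
    push_cast at h
    refine h.trans ?_
    gcongr 2 * Real.exp ?_
    have : (0 : ℝ) ≤ p := Nat.cast_nonneg p
    linarith
  have hb₃ : P.real {ω | ∃ j ∈ Finset.range (l + 1), ω ∈ s₃ j} ≤ (l + 1) * x :=
    measureReal_exists_mem_finset_le _ s₃ (le_trans (by positivity) hx) (by simp) fun j _ =>
      (hdev m j δ hδ hδ1).trans hx
  have hb := (measureReal_union_le (μ := P)
    ({ω | ∃ t ∈ Finset.range N, ω ∈ s₁ t} ∪ {ω | ∃ t ∈ Finset.range N, ω ∈ s₂ t})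
    {ω | ∃ j ∈ Finset.range (l + 1), ω ∈ s₃ j}).trans
    (add_le_add ((measureReal_union_le _ _).trans (add_le_add hb₁ hb₂)) hb₃)
  obtain ⟨E, hE, hPE, hgood⟩ := exists_measurableSet_compl_subset hb
  refine ⟨S, E, hS, hE, le_trans (by linarith) hPE, fun ω hω => ?_⟩
  have hg := hgood ω hω
  simp only [Set.mem_union, Set.mem_ofPred_eq, not_or, not_exists, not_and, Finset.mem_range, s₁,
    s₂, s₃, not_lt] at hg
  exact ⟨hg.1.1, hg.1.2, hg.2⟩

end

theorem output_eq_target_mulVec {n p N : ℕ} {φ : ℝ → ℝ} {A : Matrix (Fin n) (Fin n) ℝ}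
    {B : Matrix (Fin n) (Fin p) ℝ} {s : ℝ} (hs : s ≠ 0) (u : ℕ → Fin p → ℝ) :
    (output (state φ A B u) : Fin N → Fin n → ℝ) =
      fun k i => φ ((target s A B *ᵥ feature s (state φ A B u) u k) i) := by
  funext k i
  have h : target s A B *ᵥ feature s (state φ A B u) u k =
      A *ᵥ state φ A B u (k + 1) + B *ᵥ u (k + 1) := by
    rw [target, feature, Matrix.fromCols_mulVec_sumElim, Matrix.smul_mulVec, Matrix.mulVec_smul,
      smul_smul, inv_mul_cancel₀ hs, one_smul]
  rw [h]
  rfl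

/-- The sample-size condition lets half of the exponent pay for the net, using `n + p + 1 ≤ 2 (n +
p)`. Here `73728 = 2 * 64 * 24²`, the 2 coming from `hm`. -/
theorem pow_mul_exp_le {a ρ N L : ℝ} {m n p : ℕ} (ha : 0 < a) (hρ : 0 < ρ) (hL : 0 < L)
    (hn : 1 ≤ n) (hm : N ≤ 2 * (m * L))
    (hN : 16 / (a ^ 2 / 73728) * (n + p) ≤ N / (L * ρ ^ 2)) :
    (25 : ℝ) ^ (n + p + 1) * (2 * Real.exp (-(m * (a ^ 2 * (1 / (24 * ρ)) ^ 2 / 64)))) ≤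
      2 * Real.exp (-(a ^ 2 / 73728 / 2 * (N / (L * ρ ^ 2)))) := by
  have hn' : (1 : ℝ) ≤ n := by exact_mod_cast hn
  have hp : (0 : ℝ) ≤ p := Nat.cast_nonneg p
  set κ := a ^ 2 / 73728 with hκ
  have hκ0 : 0 < κ := by positivity
  set y := N / (L * ρ ^ 2) with hy
  have h1 : m * (a ^ 2 * (1 / (24 * ρ)) ^ 2 / 64) = κ * (2 * (m / ρ ^ 2)) := by
    rw [hκ]; field_simp; ring
  have h2 : y ≤ 2 * (m / ρ ^ 2) := by
    rw [hy, div_le_iff₀ (by positivity)]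
    calc N ≤ 2 * (m * L) := hm
      _ = _ := by field_simp
  have h3 : 8 * (n + p : ℝ) ≤ κ * y / 2 := by
    have := mul_le_mul_of_nonneg_left hN hκ0.le
    have e : κ * (16 / κ * (n + p)) = 16 * (n + p : ℝ) := by field_simp
    rw [e] at this
    linarith
  have h4 := mul_le_mul_of_nonneg_left h2 hκ0.le
  calc _ ≤ Real.exp (4 * ((n + p + 1 : ℕ) : ℝ)) * (2 * Real.exp (-(κ * (2 * (m / ρ ^ 2))))) := by
        rw [h1]; gcongr; exact pow_twentyFive_le_exp _
    _ = 2 * Real.exp (4 * ((n + p + 1 : ℕ) : ℝ) + -(κ * (2 * (m / ρ ^ 2)))) := by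
        rw [Real.exp_add]; ring
    _ ≤ _ := by
        gcongr 2 * Real.exp ?_
        push_cast
        linarith

theorem sum_sq_feature_le {n p N : ℕ} {h : ℕ → Fin n → ℝ} {u : ℕ → Fin p → ℝ} {s θ r : ℝ}
    (hs : 0 ≤ s) (hθ : 0 ≤ θ) (hr : 0 ≤ r) (hn : 1 ≤ n) {k : Fin N}
    (hh : s * eNorm (h (k + 1)) ≤ θ + r * √n) (hu : eNorm (u (k + 1)) ≤ r * √(n + p)) :
    ∑ j, feature s h u k j ^ 2 ≤ ((1 + r) ^ 2 + r ^ 2) * ((θ + √2) ^ 2 * (n + p)) := by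
  have hn' : (1 : ℝ) ≤ n := by exact_mod_cast hn
  have hp : (0 : ℝ) ≤ p := Nat.cast_nonneg p
  have h2 : 1 ≤ √2 := Real.one_le_sqrt.2 (by norm_num)
  have hq : √(n + p : ℝ) ^ 2 = n + p := Real.sq_sqrt (by positivity)
  have hq1 : 1 ≤ √(n + p : ℝ) := Real.one_le_sqrt.2 (by linarith)
  have hnq : √(n : ℝ) ≤ √(n + p : ℝ) := Real.sqrt_le_sqrt (by linarith)
  rw [← eNorm_sq, feature, eNorm_sumElim_sq, eNorm_smul, abs_of_nonneg hs]
  have hT : 1 ≤ θ + √2 := by linarith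
  have h3 : s * eNorm (h (k + 1)) ≤ (1 + r) * ((θ + √2) * √(n + p)) := by
    refine hh.trans ?_
    have e1 : θ ≤ (θ + √2) * √(n + p : ℝ) := by nlinarith
    have e2 : r * √n ≤ r * ((θ + √2) * √(n + p : ℝ)) := by gcongr; nlinarith
    linarith
  have h4 : eNorm (u (k + 1)) ≤ r * ((θ + √2) * √(n + p)) := by
    refine hu.trans ?_
    gcongr
    nlinarith
  have h5 : ((θ + √2) * √(n + p : ℝ)) ^ 2 = (θ + √2) ^ 2 * (n + p) := by rw [mul_pow, hq]
  have h6 := pow_le_pow_left₀ (mul_nonneg hs (eNorm_nonneg _)) h3 2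
  have h7 := pow_le_pow_left₀ (eNorm_nonneg _) h4 2
  rw [mul_pow _ ((θ + √2) * √(n + p : ℝ)), h5] at h6 h7
  linarith

end RNN

/-! ### Choice of constants and conclusion -/

theorem theorem4 (K : ℝ) (hK : 0 < K) :
    ∃ C c c₀ c₁ : ℝ, 0 < C ∧ 0 < c ∧ 0 < c₀ ∧ 0 < c₁ ∧
      ∀ (n p N : ℕ) (A : Matrix (Fin n) (Fin n) ℝ) (B : Matrix (Fin n) (Fin p) ℝ)
        (β : ℝ) (φ φ' : ℝ → ℝ) (Ω : Type*) (_ : MeasurableSpace Ω) (P : Measure Ω)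
        (_ : IsProbabilityMeasure P) (u : ℕ → Ω → Fin p → ℝ) (γplus γminus θ ρ : ℝ) (L : ℕ),
        ‖A‖ < 1 →
        IsBetaIncreasing β φ φ' →
        (∀ t, Measurable (u t)) →
        (∀ t, P.map (u t) = stdNormal p) →
        iIndepFun u P →
        γminus ≤ γplus →
        ρ = γplus / γminus →
        L = mixingLength c ρ n ‖A‖ →
        C * L * ρ ^ 2 * (n + p) ≤ N →
        WellBehaved K L γplus γminus θ (fun t ω => state φ A B (fun s => u s ω) t) P →
        ∃ E : Set Ω, MeasurableSet E ∧
          1 - 4 * N * Real.exp (-100 * n) - 8 * L * Real.exp (-(c₁ * (N / (L * ρ ^ 2))))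
            ≤ P.real E ∧
          ∀ ω ∈ E, ∀ (Θ₀ : Matrix (Fin n) (Fin n ⊕ Fin p) ℝ) (τ : ℕ),
            let h : ℕ → Fin n → ℝ := state φ A B (fun s => u s ω)
            let s : ℝ := 1 / Real.sqrt γplus
            let η : ℝ := c₀ * (β ^ 2 / (ρ * (θ + Real.sqrt 2) ^ 2 * (n + p)))
            let x : Fin N → Fin n ⊕ Fin p → ℝ := feature s h (fun t => u t ω)
            let y : Fin N → Fin n → ℝ := output h
            sgdError φ φ' x y η Θ₀ (target s A B) τ ≤
              (1 - c₀ * (β ^ 4 / (2 * ρ ^ 2 * (θ + Real.sqrt 2) ^ 2 * (n + p)))) ^ τ *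
                frobSq (Θ₀ - target s A B) := by
  have ha0 := sampleRate_pos K
  set a := sampleRate K with ha
  set r := 2 * √(104 / a) with hr
  have hr0 : 0 ≤ r := by positivity
  have hD : 1 ≤ (1 + r) ^ 2 + r ^ 2 := by nlinarith
  have hκ : 0 < a ^ 2 / 73728 := by positivity
  -- In `C`, the first term pays for the net and 7 for rounding to whole blocks; `c` makes the
  -- restart error small, given `‖s h_t‖ ≤ (3 + r) √n`; `c₀` makes `η ‖x_t‖² ≤ 1`; `c₁` is the half
  -- of the rate left after the net.
  refine ⟨16 / (a ^ 2 / 73728) + 7, 12 * (3 + r), 1 / ((1 + r) ^ 2 + r ^ 2), a ^ 2 / 73728 / 2,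
    by positivity, by positivity, by positivity, by positivity, ?_⟩
  intro n p N A B β φ φ' Ω _ P _ u γplus γminus θ ρ L hA hφ hu hlaw hind hγ hρ hL hN hwb
  have hγp := hwb.γplus_pos
  have hγm := hwb.γminus_pos
  have hθ0 := hwb.θ_nonneg
  have hρ1 : 1 ≤ ρ := by rw [hρ]; exact (one_le_div hγm).2 hγ
  have hρ0 : 0 < ρ := by linarith
  have hρinv : γminus / γplus = ρ⁻¹ := by rw [hρ, inv_div]
  obtain ⟨l, rfl⟩ : ∃ l, L = l + 1 := ⟨L - 1, by have := hwb.one_lt_L; omega⟩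
  have hl : 1 ≤ l := by have := hwb.one_lt_L; omega
  -- For `n = 0` the convention `log 0 = 0` gives `L = 1`, excluded by well-behavedness.
  have hn : 1 ≤ n := by
    by_contra hn
    have hn0 : n = 0 := by omega
    subst hn0
    simp [mixingLength] at hL
    omega
  have hn' : (1 : ℝ) ≤ n := by exact_mod_cast hn
  have hp' : (0 : ℝ) ≤ p := Nat.cast_nonneg p
  have hpow := pow_mul_le_one_of_mixingLength (by positivity) (norm_nonneg A) hA hL hl
  have hL0 : (0 : ℝ) < (l + 1 : ℕ) := by positivity
  have hκN : 0 ≤ 16 / (a ^ 2 / 73728) := by positivity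
  have hC : 16 / (a ^ 2 / 73728) * (n + p) ≤ N / ((l + 1 : ℕ) * ρ ^ 2) := by
    rw [le_div_iff₀ (by positivity)]
    refine le_trans ?_ hN
    have h7 : 0 ≤ 7 * ((l + 1 : ℕ) : ℝ) * ρ ^ 2 * (n + p) := by positivity
    linarith
  have hN7 : 7 * (l + 1) ≤ N := by
    have h1 : 7 * ((l + 1 : ℕ) : ℝ) ≤ N := by
      refine le_trans ?_ hN
      have e1 : 1 ≤ ρ ^ 2 * (n + p) := one_le_mul_of_one_le_of_one_le (one_le_pow₀ hρ1) (by linarith)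
      calc 7 * ((l + 1 : ℕ) : ℝ) ≤ (16 / (a ^ 2 / 73728) + 7) * (l + 1 : ℕ) * (ρ ^ 2 * (n + p)) := by
            refine le_trans ?_ (le_mul_of_one_le_right (by positivity) e1)
            gcongr
            linarith
        _ = _ := by ring
    exact_mod_cast h1
  -- One block fewer than fits, leaving room for the shift by `l`. As `N ≥ 7 L`, at least `5/7 ≥
  -- 32/45` of the samples are kept.
  obtain ⟨m, hm1, hm2⟩ : ∃ m, m * (l + 1) + (l + 1) ≤ N ∧ N < m * (l + 1) + 2 * (l + 1) := by
    have h1 : 7 ≤ N / (l + 1) := (Nat.le_div_iff_mul_le (by omega)).2 hN7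
    have h2 := Nat.div_mul_le_self N (l + 1)
    have h3 := Nat.lt_div_mul_add (a := N) (b := l + 1) (by omega)
    obtain ⟨m, hm⟩ : ∃ m, N / (l + 1) = m + 1 := ⟨N / (l + 1) - 1, by omega⟩
    rw [hm, add_mul, one_mul] at h2 h3
    exact ⟨m, h2, by omega⟩
  have hmN : (N : ℝ) ≤ 2 * (m * (l + 1 : ℕ)) := by
    have : N ≤ 2 * (m * (l + 1)) := by
      generalize m * (l + 1) = X at *
      omega
    exact_mod_cast this
  have hδ0 : 0 ≤ 1 / (24 * ρ) := by positivity
  have hδ1 : 1 / (24 * ρ) ≤ 1 := by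
    rw [div_le_one (by positivity)]; linarith
  have hφm : Measurable φ := hφ.lipschitz.continuous.measurable
  obtain ⟨S, E, hS, hE, hPE, hgood⟩ := exists_good_event hφm hu hind hlaw hK hγ hwb N m hδ0 hδ1
    (pow_mul_exp_le ha0 hρ0 hL0 hn hmN hC)
  rw [← ha, ← hr] at hgood
  refine ⟨E, hE, le_trans ?_ hPE, fun ω hω Θ₀ τ => ?_⟩
  · have e1 := Real.exp_pos (-(a ^ 2 / 73728 / 2 * (N / ((l + 1 : ℕ) * ρ ^ 2))))
    have e2 := mul_pos hL0 e1
    push_cast at e2 ⊢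
    linarith
  obtain ⟨hg1, hg2, hg3⟩ := hgood ω hω
  intro h s η x y
  have hsq : 0 < √γplus := Real.sqrt_pos.2 hγp
  have hs : 0 < s := by positivity
  have hst : ∀ t ≤ N, s * eNorm (h t) ≤ θ + r * √n := by
    intro t ht
    rcases t with _ | t
    · have : eNorm (h 0) = 0 := by simp [h, state, eNorm]
      rw [this, mul_zero]
      positivity
    · have h1 := hg1 t (by omega)
      have h2 := hwb.mean_le (t + 1)
      set c := meanVec (fun ω => state φ A B (fun s => u s ω) (t + 1)) P
      have h3 : s • h (t + 1) = s • (h (t + 1) - c) + s • c := by module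
      have h4 := eNorm_add_le (s • (h (t + 1) - c)) (s • c)
      rw [← h3, eNorm_smul, eNorm_smul s c, abs_of_pos hs] at h4
      have h5 : s * eNorm c ≤ θ := by
        calc s * eNorm c ≤ s * (θ * √γplus) := by gcongr
          _ = θ := by simp only [s]; field_simp
      linarith
  have hy : y = fun k i => φ ((target s A B *ᵥ x k) i) := output_eq_target_mulVec hs.ne' _
  have hT : 1 ≤ (θ + √2) ^ 2 := by
    have : 1 ≤ √2 := Real.one_le_sqrt.2 (by norm_num)
    exact one_le_pow₀ (by linarith)
  have hQ : 1 ≤ (θ + √2) ^ 2 * (n + p) := one_le_mul_of_one_le_of_one_le hT (by linarith)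
  have hβ2 : β ^ 2 ≤ 1 := pow_le_one₀ hφ.beta_nonneg hφ.beta_le_one
  have hη : 0 ≤ η := by positivity
  set D := (1 + r) ^ 2 + r ^ 2 with hDdef
  have hD0 : 0 < D := by linarith
  have hηD : η * (D * ((θ + √2) ^ 2 * (n + p))) ≤ 1 := by
    have e : η * (D * ((θ + √2) ^ 2 * (n + p))) = β ^ 2 / ρ := by
      simp only [η]; field_simp; rw [hDdef]; ring
    rw [e, div_le_one hρ0]
    linarith
  have hx : ∀ k, η * ∑ j, x k j ^ 2 ≤ 1 := by
    intro k
    refine (mul_le_mul_of_nonneg_left ?_ hη).trans hηD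
    exact sum_sq_feature_le hs.le hθ0 hr0 hn (hst _ (by omega)) (hg2 _ k.2)
  -- The mixing length gives `‖A‖^l * (c n ρ) ≤ 1` with `c = 12 (3 + r)`, while `θ ≤ 3 √n` bounds
  -- the rescaled state.
  have hpert : ∀ t < m * (l + 1), s * eNorm (state φ A B (fun s => u s ω) (t + l) -
      state φ A B (fun j => u (t + j) ω) l) ≤ √n / (12 * n * ρ) := by
    intro t ht
    have h1 := eNorm_state_add_sub_le A B hφ.lipschitz (fun s => u s ω) t l
    have h2 := hst t (by omega)
    have h3 : s * eNorm (h t) ≤ (3 + r) * √n := by linarith [hwb.θ_le]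
    calc _ ≤ s * (‖A‖ ^ l * eNorm (h t)) := by gcongr
      _ = ‖A‖ ^ l * (s * eNorm (h t)) := by ring
      _ ≤ ‖A‖ ^ l * ((3 + r) * √n) := by gcongr
      _ = ‖A‖ ^ l * (12 * (3 + r) * n * ρ) * (√n / (12 * n * ρ)) := by field_simp
      _ ≤ 1 * (√n / (12 * n * ρ)) := by gcongr
      _ = _ := one_mul _
  have hε2 : (√n / (12 * n * ρ)) ^ 2 ≤ 1 / (144 * ρ) := by
    rw [div_pow, Real.sq_sqrt (by positivity), div_le_div_iff₀ (by positivity) (by positivity)]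
    have e1 : 1 ≤ n * ρ := one_le_mul_of_one_le_of_one_le hn' hρ1
    have e2 : (0 : ℝ) ≤ 144 * n * ρ := by positivity
    calc (n : ℝ) * (144 * ρ) = 144 * n * ρ * 1 := by ring
      _ ≤ 144 * n * ρ * (n * ρ) := mul_le_mul_of_nonneg_left e1 e2
      _ = _ := by ring
  rw [hρinv] at hS
  have hlow := sum_sq_feature_ge (N := N) (fun s => u s ω)
    (meanVec (fun ω => state φ A B (fun s => u s ω) l) P) hs.le hρ1 hl hpert hε2 hS hg3
    (by omega) (by generalize m * (l + 1) = X at *; omega)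
  have e : η * β ^ 2 * (1 / (2 * ρ)) =
      1 / D * (β ^ 4 / (2 * ρ ^ 2 * (θ + √2) ^ 2 * (n + p))) := by
    simp only [η]; field_simp; rw [hDdef]; ring
  rw [hy, ← e]
  refine sgdError_le hφ (by omega) x Θ₀ (target s A B) hη hx hlow ?_ τ
  have h1 : η ≤ 1 := by
    have : 1 ≤ D * ((θ + √2) ^ 2 * (n + p)) := one_le_mul_of_one_le_of_one_le hD hQ
    exact (le_mul_of_one_le_right hη this).trans hηD
  have h2 : η * β ^ 2 ≤ 1 := mul_le_one₀ h1 (sq_nonneg β) hβ2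
  have h3 : 1 / (2 * ρ) ≤ 1 := by rw [div_le_one (by positivity)]; linarith
  have h4 := mul_le_one₀ h2 (by positivity : 0 ≤ 1 / (2 * ρ)) h3
  linarith
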